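/- \textbf{Setting.} Let $T>0$, $L>0$, $\mu>0$. Let $V$ and $H$ be real separable Hilbert spaces, with $V$ continuously and densely embedded in $H$, and let $V\hookrightarrow H\cong H^*\hookrightarrow V^*$ be the resulting Gelfand triple. Let $\mathcal A\colon[0,T]\times V\to V^*$ be such that (i) $t\mapsto\langle\mathcal A(t)v_1,v_2\rangle$ is measurable for all $v_1,v_2\in V$; (ii) $\|\mathcal A(t)0\|_{V^*}\le M$ for all $t\in[0,T]$, for some constant $M$; (iii) $\|\mathcal A(t)v_1-\mathcal A(t)v_2\|_{V^*}\le L\|v_1-v_2\|_V$ for all $t\in[0,T]$, $v_1,v_2\in V$; (iv) $\langle\mathcal A(t)v_1-\mathcal A(t)v_2,v_1-v_2\rangle\ge\mu\|v_1-v_2\|_V^2$ for all $t\in[0,T]$, $v_1,v_2\in V$. Let $f\in L^2(0,T;H)$ and $u_0\in V$, and let $u$ be the weak solution of $\dot u(t)+\mathcal A(t)u(t)=f(t)$, $u(0)=u_0$; that is, $u\in L^2(0,T;V)$ has a weak derivative $\dot u\in L^2(0,T;V^*)$, its continuous $H$-valued representative equals $u_0$ at $t=0$, and $\int_0^T\langle\dot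 u+\mathcal A(t)u,v\rangle\,dt=\int_0^T\langle f,v\rangle\,dt$ for all $v\in L^2(0,T;V)$. Suppose that $u\in C^\gamma([0,T];V)$ for some $\gamma\in(0,1)$ and that $\mathcal A(\cdot)u(\cdot)\in L^2(0,T;H)$. Here $\|u\|_{C^\gamma([0,T];V)}=\sup_t\|u(t)\|_V+\sup_{s\ne t}\|u(s)-u(t)\|_V/|s-t|^\gamma$. Let $(V_h)_{h\in(0,1)}$ be finite-dimensional subspaces of $V$. Let $P_h\colon H\to V_h$ be the $H$-orthogonal projection, with $\|P_h\|_{\mathcal L(V)}$ the operator norm of its restriction to $V$, and define $\mathcal A_h(t)\colon V_h\to V_h$ by $(\mathcal A_h(t)v_h,w_h)_H=\langle\mathcal A(t)v_h,w_h\rangle$ for all $w_h\in V_h$. For $X\in\{H,V\}$ put $\mathrm{dist}_X(v,V_h)=\inf_{v_h\in V_h}\|v-v_h\|_X$. For an integer $N\ge1$ let $k=T/N$ and $t_n=nk$. Let $(\tau_n)_{n\ge1}$ be independent random variables on a probability space $\Omega$, uniformly distributed on $(0,1)$, and put $\xi_n=t_{n-1}+k\tau_n$. The randomized backward Euler--Galerkin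 scheme is $$U_h^0=P_hu_0,\qquad U_h^n+k\mathcal A_h(\xi_n)U_h^n=kP_hf(\xi_n)+U_h^{n-1}\quad\text{almost surely, } n=1,\dots,N.$$ \textbf{Theorem.} There is a constant $C$ depending only on $L$, $\mu$ and $T$ such that, in every such setting and for every $N\ge1$ and $h\in(0,1)$, the scheme has a solution, every solution satisfies $U_h^n\in L^2(\Omega;V_h)$ for $n=0,\dots,N$, and $$\max_{0\le n\le N}\|U_h^n-u(t_n)\|_{L^2(\Omega;H)}+\Big(k\sum_{n=1}^N\|U_h^n-u(t_n)\|_{L^2(\Omega;V)}^2\Big)^{1/2}$$ $$\le C\Big(k^{1/2}\big(\|f\|_{L^2(0,T;H)}+\|\mathcal A(\cdot)u(\cdot)\|_{L^2(0,T;H)}\big)+k^\gamma\|u\|_{C^\gamma([0,T];V)}+\max_{0\le n\le N}\mathrm{dist}_H(u(t_n),V_h)$$ $$\qquad+\big(1+\|P_h\|_{\mathcal L(V)}\big)\Big(k\sum_{n=1}^N\mathrm{dist}_V(u(t_n),V_h)^2\Big)^{1/2}\Big).$$ -/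

import Mathlib

open MeasureTheory

noncomputable section

namespace GalerkinEuler

variable {V H : Type*}
  [NormedAddCommGroup V] [InnerProductSpace ℝ V]
  [NormedAddCommGroup H] [InnerProductSpace ℝ H]

/-! ### Bochner-Lebesgue and Hölder norms -/

/-- Lebesgue measure on `(0, T)`; the space `L²(0, T; X)` consists of the `f : ℝ → X` with
`MemLp f 2 (timeMeasure T)`. -/
def timeMeasure (T : ℝ) : Measure ℝ := volume.restrict (Set.Ioo 0 T)

/-- The real number `‖g‖_{L²(ν; X)}`, the square root of `∫ ‖g‖² dν` (for `MemLp g 2 ν`). -/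
def l2norm {α X : Type*} [MeasurableSpace α] [NormedAddCommGroup X] (ν : Measure α)
    (g : α → X) : ℝ :=
  (eLpNorm g 2 ν).toReal

/-- `u ∈ C^γ([0, T]; X)`. -/
def MemHolderSpace {X : Type*} [NormedAddCommGroup X] (T : ℝ) (γ : NNReal) (u : ℝ → X) : Prop :=
  MemHolder γ (fun t : Set.Icc (0 : ℝ) T => u t)

/-- `‖u‖_{C^γ([0, T]; X)}`: the supremum of `‖u t‖` plus the Hölder seminorm. -/
def holderSpaceNorm {X : Type*} [NormedAddCommGroup X] (T : ℝ) (γ : NNReal) (u : ℝ → X) : ℝ :=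
  (⨆ t : Set.Icc (0 : ℝ) T, ‖u t‖) + (nnHolderNorm γ (fun t : Set.Icc (0 : ℝ) T => u t) : ℝ)

/-! ### The Gelfand triple and the evolution equation -/

/-- The embedding `H ≅ H* → V*` that belongs to the embedding `ι : V → H`: the functional
`v ↦ (g, ι v)_H`. -/
def toDualV (ι : V →L[ℝ] H) (g : H) : StrongDual ℝ V := (innerSL ℝ g).comp ι

/-- The conditions on `A : [0, T] × V → V*` (values of `A` at times outside `[0, T]` play no
role): weak Lebesgue measurability in time, boundedness of `A(t) 0` by `M`, Lipschitz continuity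
with constant `L` and strong monotonicity with constant `μ`. -/
structure IsMonotoneFamily (T M L μ : ℝ) (A : ℝ → V → StrongDual ℝ V) : Prop where
  measurable : ∀ v₁ v₂ : V, AEMeasurable (fun t => A t v₁ v₂) (timeMeasure T)
  bound_zero : ∀ t ∈ Set.Icc 0 T, ‖A t 0‖ ≤ M
  lipschitz : ∀ t ∈ Set.Icc 0 T, ∀ v₁ v₂ : V, ‖A t v₁ - A t v₂‖ ≤ L * ‖v₁ - v₂‖
  strongly_monotone : ∀ t ∈ Set.Icc 0 T, ∀ v₁ v₂ : V,
    μ * ‖v₁ - v₂‖ ^ 2 ≤ (A t v₁ - A t v₂) (v₁ - v₂)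

/-- `w : (0, T) → V*` is the weak (distributional) time derivative of `u : (0, T) → V`, where `u`
is regarded as `V*`-valued through `V → H ≅ H* → V*`. -/
def IsWeakTimeDeriv (ι : V →L[ℝ] H) (T : ℝ) (u : ℝ → V) (w : ℝ → StrongDual ℝ V) : Prop :=
  ∀ φ : ℝ → ℝ, ContDiff ℝ (⊤ : ℕ∞) φ → HasCompactSupport φ → tsupport φ ⊆ Set.Ioo 0 T →
    ∫ t, deriv φ t • toDualV ι (ι (u t)) ∂timeMeasure T = -∫ t, φ t • w t ∂timeMeasure T

/-- `u ∈ 𝒲(0, T)` is a weak solution of `u' + A(t) u = f`, `u(0) = u₀`. The initial value is that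
of the continuous `H`-valued representative of `u`. -/
structure IsWeakSolution (ι : V →L[ℝ] H) (T : ℝ) (A : ℝ → V → StrongDual ℝ V) (f : ℝ → H)
    (u₀ : H) (u : ℝ → V) : Prop where
  memLp : MemLp u 2 (timeMeasure T)
  weak_eq : ∃ u' : ℝ → StrongDual ℝ V,
    MemLp u' 2 (timeMeasure T) ∧ IsWeakTimeDeriv ι T u u' ∧
    ∀ v : ℝ → V, MemLp v 2 (timeMeasure T) →
      ∫ t, (u' t + A t (u t)) (v t) ∂timeMeasure T
        = ∫ t, (toDualV ι (f t)) (v t) ∂timeMeasure T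
  initial : ∃ c : ℝ → H, ContinuousOn c (Set.Icc 0 T) ∧
    (∀ᵐ t ∂timeMeasure T, ι (u t) = c t) ∧ c 0 = u₀

/-! ### The Galerkin space -/

/-- A subspace `W` of `V` is identified with its image in `H`. -/
def imageEquiv (ι : V →L[ℝ] H) (hι : Function.Injective ι) (W : Submodule ℝ V) :
    W ≃ₗ[ℝ] W.map (ι : V →ₗ[ℝ] H) :=
  W.equivMapOfInjective (ι : V →ₗ[ℝ] H) hι

theorem imageEquiv_coe (ι : V →L[ℝ] H) (hι : Function.Injective ι) (W : Submodule ℝ V) (w : W) :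
    (imageEquiv ι hι W w : H) = ι w := rfl

theorem imageEquiv_symm_coe (ι : V →L[ℝ] H) (hι : Function.Injective ι) (W : Submodule ℝ V)
    (x : W.map (ι : V →ₗ[ℝ] H)) : ι ((imageEquiv ι hι W).symm x : V) = x := by
  rw [← imageEquiv_coe ι hι W, LinearEquiv.apply_symm_apply]

/-- The projection `P_h : H → V_h`, orthogonal for the inner product of `H`, onto the
finite-dimensional space `W = V_h ⊆ V`. -/
def galerkinProj (ι : V →L[ℝ] H) (hι : Function.Injective ι) (W : Submodule ℝ V)
    [FiniteDimensional ℝ W] : H →L[ℝ] W :=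
  (LinearMap.toContinuousLinearMap
    ((imageEquiv ι hι W).symm : W.map (ι : V →ₗ[ℝ] H) →ₗ[ℝ] W)).comp
    (W.map (ι : V →ₗ[ℝ] H)).orthogonalProjectionOnto

/-- `‖P_h‖_{L(V)}`, the operator norm of the restriction of `P_h` to `V` as a map from `V` to
`V`. -/
def galerkinProjNormV (ι : V →L[ℝ] H) (hι : Function.Injective ι) (W : Submodule ℝ V)
    [FiniteDimensional ℝ W] : ℝ :=
  ‖(W.subtypeL.comp ((galerkinProj ι hι W).comp ι) : V →L[ℝ] V)‖

/-- The Riesz representative in `(W, (·,·)_H)` of the restriction to `W` of `ψ ∈ V*`. -/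
def galerkinRiesz (ι : V →L[ℝ] H) (hι : Function.Injective ι) (W : Submodule ℝ V)
    [FiniteDimensional ℝ W] (ψ : StrongDual ℝ V) : W :=
  (imageEquiv ι hι W).symm
    ((InnerProductSpace.toDual ℝ (W.map (ι : V →ₗ[ℝ] H))).symm
      (LinearMap.toContinuousLinearMap
        ((ψ : V →ₗ[ℝ] ℝ) ∘ₗ W.subtype ∘ₗ
          ((imageEquiv ι hι W).symm : W.map (ι : V →ₗ[ℝ] H) →ₗ[ℝ] W))))

theorem inner_galerkinProj (ι : V →L[ℝ] H) (hι : Function.Injective ι) (W : Submodule ℝ V)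
    [FiniteDimensional ℝ W] (g : H) (w : W) :
    inner ℝ (ι (galerkinProj ι hι W g : V)) (ι w) = inner ℝ g (ι w) := by
  have h1 : ι (galerkinProj ι hι W g : V)
      = ((W.map (ι : V →ₗ[ℝ] H)).orthogonalProjectionOnto g : H) :=
    imageEquiv_symm_coe ι hι W _
  rw [h1, ← imageEquiv_coe ι hι W w]
  rw [← Submodule.coe_inner]
  exact Submodule.inner_orthogonalProjectionOnto_eq_of_mem_right (imageEquiv ι hι W w) g

theorem inner_galerkinRiesz (ι : V →L[ℝ] H) (hι : Function.Injective ι) (W : Submodule ℝ V)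
    [FiniteDimensional ℝ W] (ψ : StrongDual ℝ V) (w : W) :
    inner ℝ (ι (galerkinRiesz ι hι W ψ : V)) (ι w) = ψ w := by
  have h1 : ι (galerkinRiesz ι hι W ψ : V)
      = (((InnerProductSpace.toDual ℝ (W.map (ι : V →ₗ[ℝ] H))).symm
      (LinearMap.toContinuousLinearMap
        ((ψ : V →ₗ[ℝ] ℝ) ∘ₗ W.subtype ∘ₗ
          ((imageEquiv ι hι W).symm : W.map (ι : V →ₗ[ℝ] H) →ₗ[ℝ] W))) :
            W.map (ι : V →ₗ[ℝ] H)) : H) :=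
    imageEquiv_symm_coe ι hι W _
  rw [h1, ← imageEquiv_coe ι hι W w, ← Submodule.coe_inner, InnerProductSpace.toDual_symm_apply]
  simp

/-- An element of `W` is determined by its `H`-inner products with the elements of `W`. -/
theorem galerkin_ext (ι : V →L[ℝ] H) (hι : Function.Injective ι) (W : Submodule ℝ V) (x y : W)
    (h : ∀ w : W, inner ℝ (ι x) (ι w) = (inner ℝ (ι y) (ι w) : ℝ)) : x = y := by
  have h2 : inner ℝ (ι (x : V) - ι (y : V)) (ι (x : V) - ι (y : V)) = (0 : ℝ) := by
    have := h (x - y)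
    rw [Submodule.coe_sub, map_sub] at this
    rw [inner_sub_left, this, sub_self]
  exact Subtype.ext (hι (sub_eq_zero.mp (inner_self_eq_zero.mp h2)))

/-- The discrete operator `A_h(t) : V_h → V_h`, `(A_h(t) v, w)_H = ⟨A(t) v, w⟩`. -/
def discreteOp (ι : V →L[ℝ] H) (hι : Function.Injective ι) (W : Submodule ℝ V)
    [FiniteDimensional ℝ W] (A : ℝ → V → StrongDual ℝ V) (t : ℝ) (v : W) : W :=
  galerkinRiesz ι hι W (A t v)

/-- `dist_H(v, V_h)`. -/
def distH (ι : V →L[ℝ] H) (W : Submodule ℝ V) (v : V) : ℝ := ⨅ w : W, ‖ι v - ι (w : V)‖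

/-- `dist_V(v, V_h)`. -/
def distV (W : Submodule ℝ V) (v : V) : ℝ := ⨅ w : W, ‖v - (w : V)‖

/-! ### The randomized backward Euler-Galerkin scheme -/

/-- `τ 0, τ 1, …` are independent and uniformly distributed on `(0, 1)`. -/
structure IsUniformSequence {Ω : Type*} [MeasurableSpace Ω] (P : Measure Ω) (τ : ℕ → Ω → ℝ) :
    Prop where
  measurable : ∀ n, Measurable (τ n)
  indep : ProbabilityTheory.iIndepFun τ P
  law : ∀ n, P.map (τ n) = volume.restrict (Set.Ioo (0 : ℝ) 1)

/-- The random time `ξ_{n+1} = t_n + k τ`, with `t_n = n k`, uniformly distributed on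
`(t_n, t_{n+1})`. The `n`-th variable of the sequence `τ` (counted from `0`) belongs to the step
from `t_n` to `t_{n+1}`. -/
def randomTime {Ω : Type*} (k : ℝ) (τ : ℕ → Ω → ℝ) (n : ℕ) (ω : Ω) : ℝ := n * k + k * τ n ω

/-- `U^0, …, U^N` solves, almost surely, the scheme `U^0 = P_h u₀`,
`U^{n+1} + k A_h(ξ_{n+1}) U^{n+1} = k P_h f(ξ_{n+1}) + U^n` for `0 ≤ n < N`. -/
structure IsSchemeSolution {Ω : Type*} [MeasurableSpace Ω] (P : Measure Ω) (τ : ℕ → Ω → ℝ)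
    (ι : V →L[ℝ] H) (hι : Function.Injective ι) (W : Submodule ℝ V) [FiniteDimensional ℝ W]
    (A : ℝ → V → StrongDual ℝ V) (f : ℝ → H) (u₀ : H) (k : ℝ) (N : ℕ) (U : ℕ → Ω → W) :
    Prop where
  initial : ∀ᵐ ω ∂P, U 0 ω = galerkinProj ι hι W u₀
  step : ∀ᵐ ω ∂P, ∀ n < N,
    U (n + 1) ω + k • discreteOp ι hι W A (randomTime k τ n ω) (U (n + 1) ω)
      = k • galerkinProj ι hι W (f (randomTime k τ n ω)) + U n ω

end GalerkinEuler

end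

open GalerkinEuler

/-! The proof is an energy estimate for the discrete error θⁿ = Uⁿ − P_h u(t_n). Since f − Au takes
values in H, the evolution equation integrates to u(t_{n+1}) − u(t_n) = ∫ (f − Au) over the step
(`IsWeakSolution.sub_eq_integral`). Subtracting this from the scheme and testing with θⁿ⁺¹ leaves
two errors: the consistency term A(ξ)u(ξ) − A(ξ)P_h u(t_{n+1}), and the quadrature error D = k(f −
Au)(ξ) − ∫ (f − Au).

Lipschitz continuity and Young's inequality absorb the consistency term into half of the coercivity.
Its size is that of u(ξ) − P_h u(t_{n+1}) in V, hence the Hölder term plus (1 + ‖P_h‖) dist_V. For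
D, write (D, θⁿ⁺¹) = (D, θⁿ) + (D, θⁿ⁺¹ − θⁿ). The second product is absorbed by the dissipation
‖θⁿ⁺¹ − θⁿ‖² of implicit Euler (`energy_step`). The first has expectation zero: D has mean zero
because ξ is uniform on the step, and θⁿ depends only on earlier random times. What remains is E‖D‖²
≤ k ∫ ‖f − Au‖² (`integral_quadrature_error`), whose sum over the steps has order k. As θ⁰ = 0, the
inequalities telescope without any Gronwall argument (`energy_estimate`), and the triangle
inequality then adds the projection errors.

The independence argument needs each iterate to be a square integrable function of the earlier
random variables, although U is not assumed measurable. Each step is an equation with a strongly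
monotone Lipschitz map, so it is uniquely solvable for almost every t with a jointly measurable
solution map (`exists_measurable_step`). Uniqueness then makes every solution of the scheme a
composition of such maps, almost surely. -/

namespace GalerkinEuler
open Filter Topology

/-! ### Strongly monotone Lipschitz maps -/

section Resolvent

variable {E : Type*} [NormedAddCommGroup E] [InnerProductSpace ℝ E]

/-- A strongly monotone map (with constant `1`) expands distances. -/
theorem norm_sub_le_of_monotone {G : E → E}
    (hm : ∀ x y, ‖x - y‖ ^ 2 ≤ inner ℝ (G x - G y) (x - y)) (x y : E) :
    ‖x - y‖ ≤ ‖G x - G y‖ := by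
  have h := (hm x y).trans (real_inner_le_norm _ _)
  rcases (norm_nonneg (x - y)).eq_or_lt with h0 | h0
  · rw [← h0]; exact norm_nonneg _
  · rw [sq] at h
    exact le_of_mul_le_mul_right h h0

/-- A damped Richardson step for a strongly monotone Lipschitz map is a contraction. -/
theorem contractingWith_richardson {G : E → E} {K : ℝ} (hK : 1 ≤ K)
    (hl : ∀ x y, ‖G x - G y‖ ≤ K * ‖x - y‖)
    (hm : ∀ x y, ‖x - y‖ ^ 2 ≤ inner ℝ (G x - G y) (x - y)) (g : E) :
    ContractingWith (Real.toNNReal √(1 - (K ^ 2)⁻¹))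
      (fun x => x - (K ^ 2)⁻¹ • (G x - g)) := by
  have hK2 : 0 < K ^ 2 := by positivity
  have hi1 : (K ^ 2)⁻¹ ≤ 1 := inv_le_one_of_one_le₀ (by nlinarith)
  refine ⟨?_, LipschitzWith.of_dist_le_mul fun x y => ?_⟩
  · rw [← Real.toNNReal_one, Real.toNNReal_lt_toNNReal_iff one_pos, Real.sqrt_lt' one_pos]
    have : 0 < (K ^ 2)⁻¹ := by positivity
    linarith
  · rw [Real.coe_toNNReal _ (Real.sqrt_nonneg _), dist_eq_norm, dist_eq_norm]
    have e : x - (K ^ 2)⁻¹ • (G x - g) - (y - (K ^ 2)⁻¹ • (G y - g))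
        = (x - y) - (K ^ 2)⁻¹ • (G x - G y) := by
      simp only [smul_sub]; abel
    rw [e]
    refine abs_le_of_sq_le_sq' ?_ (by positivity) |>.2
    -- In the expanded square the cross term contributes at most −2K⁻²‖x − y‖² and the quadratic
    -- term at most K⁻⁴ · K² = K⁻², so the factor is 1 − K⁻².
    rw [mul_pow, Real.sq_sqrt (by linarith), norm_sub_sq_real, inner_smul_right, norm_smul,
      Real.norm_of_nonneg (by positivity), real_inner_comm]
    have h1 := hm x y
    have h2 : ‖G x - G y‖ ^ 2 ≤ K ^ 2 * ‖x - y‖ ^ 2 := by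
      rw [← mul_pow]; exact pow_le_pow_left₀ (norm_nonneg _) (hl x y) 2
    have h3 : ((K ^ 2)⁻¹ * ‖G x - G y‖) ^ 2 ≤ (K ^ 2)⁻¹ * ‖x - y‖ ^ 2 := by
      calc _ = (K ^ 2)⁻¹ * ((K ^ 2)⁻¹ * ‖G x - G y‖ ^ 2) := by ring
        _ ≤ (K ^ 2)⁻¹ * ((K ^ 2)⁻¹ * (K ^ 2 * ‖x - y‖ ^ 2)) := by gcongr
        _ = _ := by field_simp
    have h4 := mul_le_mul_of_nonneg_left h1 (inv_nonneg.2 hK2.le)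
    linarith

/-- The equation `G a x = g`, with `G a` Lipschitz and strongly monotone, has a solution that
depends measurably on `(a, g)`. -/
theorem exists_measurable_resolvent [CompleteSpace E] [MeasurableSpace E] [BorelSpace E]
    [SecondCountableTopology E] {α : Type*} [MeasurableSpace α] {G : α → E → E}
    (hG : Measurable (Function.uncurry G)) {K : ℝ} (hK : 1 ≤ K)
    (hl : ∀ a x y, ‖G a x - G a y‖ ≤ K * ‖x - y‖)
    (hm : ∀ a x y, ‖x - y‖ ^ 2 ≤ inner ℝ (G a x - G a y) (x - y)) :
    ∃ R : α × E → E, Measurable R ∧ ∀ a g, G a (R (a, g)) = g := by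
  -- The fixed point is recorded as the limit of the iterates started at 0: each iterate is
  -- measurable in the parameters, hence so is the limit.
  have hc : ∀ p : α × E, ∃ x, Function.IsFixedPt (fun x => x - (K ^ 2)⁻¹ • (G p.1 x - p.2)) x ∧
      Tendsto (fun n => (fun x => x - (K ^ 2)⁻¹ • (G p.1 x - p.2))^[n] 0) atTop (𝓝 x) := fun p =>
    have h := contractingWith_richardson hK (hl p.1) (hm p.1) p.2
    ⟨_, h.fixedPoint_isFixedPt, h.tendsto_iterate_fixedPoint 0⟩
  choose R hR hlim using hc
  refine ⟨R, ?_, fun a g => ?_⟩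
  · refine measurable_of_tendsto_metrizable
      (f := fun n p => (fun x => x - (K ^ 2)⁻¹ • (G p.1 x - p.2))^[n] 0) (fun n => ?_)
      (tendsto_pi_nhds.2 hlim)
    induction n with
    | zero => exact measurable_const
    | succ n ih =>
      simp only [Function.iterate_succ_apply']
      have : Measurable fun p : α × E =>
          G p.1 ((fun x => x - (K ^ 2)⁻¹ • (G p.1 x - p.2))^[n] 0) :=
        hG.comp (measurable_fst.prodMk ih)
      exact ih.sub ((this.sub measurable_snd).const_smul _)
  · have h2 : (K ^ 2)⁻¹ • (G a (R (a, g)) - g) = 0 := by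
      have h := (hR (a, g)).eq
      exact sub_eq_self.1 h
    rcases smul_eq_zero.1 h2 with h3 | h3
    · exact absurd h3 (by positivity)
    · exact sub_eq_zero.1 h3

end Resolvent

/-! ### Carathéodory maps -/

/-- A family of Lipschitz maps that is weakly a.e. measurable in the parameter agrees almost
everywhere with a jointly measurable one, whose members are members of the family or zero. -/
theorem exists_measurable_modification {E : Type*} [NormedAddCommGroup E] [InnerProductSpace ℝ E]
    [FiniteDimensional ℝ E] [MeasurableSpace E] [BorelSpace E]
    {α : Type*} [MeasurableSpace α] {ν : Measure α} {B : α → E → E} {K : ℝ}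
    (hB : ∀ x y, AEMeasurable (fun t => (inner ℝ (B t x) y : ℝ)) ν)
    (hl : ∀ᵐ t ∂ν, ∀ x y, ‖B t x - B t y‖ ≤ K * ‖x - y‖) :
    ∃ B' : α → E → E, Measurable (Function.uncurry B') ∧ (∀ᵐ t ∂ν, B' t = B t) ∧
      ∀ t, B' t = 0 ∨ (B' t = B t ∧ ∀ x y, ‖B t x - B t y‖ ≤ K * ‖x - y‖) := by
  have hB1 : ∀ x, AEMeasurable (fun t => B t x) ν := fun x => by
    have : (fun t => B t x) = fun t => ∑ i, (inner ℝ (B t x) (stdOrthonormalBasis ℝ E i) : ℝ) •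
        stdOrthonormalBasis ℝ E i := by
      funext t
      conv_lhs => rw [← (stdOrthonormalBasis ℝ E).sum_repr' (B t x)]
      simp only [real_inner_comm]
    rw [this]
    exact Finset.aemeasurable_fun_sum _ fun i _ => (hB x _).smul_const _
  have hall : ∀ᵐ t ∂ν, (∀ n, B t (TopologicalSpace.denseSeq E n)
      = (hB1 (TopologicalSpace.denseSeq E n)).mk _ t) ∧
        ∀ x y, ‖B t x - B t y‖ ≤ K * ‖x - y‖ :=
    (ae_all_iff.2 fun n => (hB1 _).ae_eq_mk).and hl
  -- On a measurable conull set the family has its measurable versions at countably many dense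
  -- points. Continuity in x carries measurability to all points and then to joint measurability.
  obtain ⟨G, hGsub, hGm, hGae⟩ : ∃ G : Set α, G ⊆ {t | (∀ n, B t (TopologicalSpace.denseSeq E n)
      = (hB1 (TopologicalSpace.denseSeq E n)).mk _ t) ∧
        ∀ x y, ‖B t x - B t y‖ ≤ K * ‖x - y‖} ∧ MeasurableSet G ∧ ∀ᵐ t ∂ν, t ∈ G := by
    obtain ⟨Z, hZ, hZm, hZ0⟩ := exists_measurable_superset_of_null hall
    refine ⟨Zᶜ, fun t ht => ?_, hZm.compl, by rw [ae_iff]; simpa using hZ0⟩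
    by_contra h
    exact ht (hZ h)
  classical
  refine ⟨fun t => if t ∈ G then B t else 0, ?_, ?_, ?_⟩
  · have hcont : ∀ t, Continuous (if t ∈ G then B t else 0) := fun t => by
      split_ifs with h
      · exact (LipschitzWith.of_dist_le' fun x y => by
          simpa [dist_eq_norm] using (hGsub h).2 x y).continuous
      · exact continuous_const
    have hmeas : ∀ x, Measurable fun t => (if t ∈ G then B t else 0 : E → E) x := fun x => by
      have hcl := TopologicalSpace.denseRange_denseSeq E x
      rw [mem_closure_iff_seq_limit] at hcl
      obtain ⟨s, hs, hlim⟩ := hcl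
      refine measurable_of_tendsto_metrizable
        (f := fun n t => (if t ∈ G then B t else 0 : E → E) (s n)) (fun n => ?_)
        (tendsto_pi_nhds.2 fun t => ((hcont t).tendsto x).comp hlim)
      obtain ⟨j, hj⟩ := hs n
      rw [← hj]
      have : (fun t => (if t ∈ G then B t else 0 : E → E) (TopologicalSpace.denseSeq E j))
          = G.indicator ((hB1 (TopologicalSpace.denseSeq E j)).mk _) := by
        funext t
        by_cases h : t ∈ G
        · simp only [h, if_true, Set.indicator_of_mem]; exact (hGsub h).1 j
        · simp [h]
      rw [this]
      exact (hB1 _).measurable_mk.indicator hGm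
    have := measurable_uncurry_of_continuous_of_measurable
      (u := fun x t => (if t ∈ G then B t else 0 : E → E) x) hcont hmeas
    exact this.comp measurable_swap
  · filter_upwards [hGae] with t ht
    simp [ht]
  · intro t
    by_cases h : t ∈ G
    · right; simp only [h, if_true, true_and]; exact (hGsub h).2
    · left; simp [h]

/-! ### The random times -/

section RandomTime

variable {Ω : Type*} [MeasurableSpace Ω] {P : Measure Ω} {τ : ℕ → Ω → ℝ} {k : ℝ}

theorem measurable_randomTime (hτ : IsUniformSequence P τ) (k : ℝ) (n : ℕ) :
    Measurable (randomTime k τ n) := by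
  have := hτ.measurable n
  unfold randomTime
  fun_prop

/-- The random time `ξ_{n+1}` is uniformly distributed on `(t_n, t_{n+1})`. -/
theorem map_randomTime (hτ : IsUniformSequence P τ) (hk : 0 < k) (n : ℕ) :
    P.map (randomTime k τ n)
      = ENNReal.ofReal k⁻¹ • volume.restrict (Set.Ioo (n * k) ((n + 1 : ℕ) * k)) := by
  have h1 : randomTime k τ n = (fun x : ℝ => n * k + x) ∘ (fun x : ℝ => k * x) ∘ τ n := rfl
  have hm1 : Measurable fun x : ℝ => k * x := measurable_const_mul k
  have hm2 : Measurable fun x : ℝ => n * k + x := measurable_const_add _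
  have e1 : Set.Ioo (0 : ℝ) 1 = (fun x => k * x) ⁻¹' Set.Ioo 0 k := by
    ext x
    simp only [Set.mem_Ioo, Set.mem_preimage, mul_pos_iff_of_pos_left hk]
    rw [mul_lt_iff_lt_one_right hk]
  have e2 : Set.Ioo (0 : ℝ) k = (fun x => n * k + x) ⁻¹' Set.Ioo (n * k) ((n + 1 : ℕ) * k) := by
    ext x
    simp only [Set.mem_Ioo, Set.mem_preimage, Nat.cast_add, Nat.cast_one, add_mul, one_mul]
    constructor <;> rintro ⟨h, h'⟩ <;> constructor <;> linarith
  rw [h1, ← Measure.map_map hm2 (hm1.comp (hτ.measurable n)),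
    ← Measure.map_map hm1 (hτ.measurable n), hτ.law n, e1,
    ← Measure.restrict_map hm1 measurableSet_Ioo, Real.map_volume_mul_left hk.ne',
    abs_of_pos (inv_pos.2 hk), Measure.restrict_smul, Measure.map_smul, e2,
    ← Measure.restrict_map hm2 measurableSet_Ioo, map_add_left_eq_self]

theorem restrict_Ioo_le_timeMeasure {T : ℝ} {N n : ℕ} (hN : 0 < N) (hk : 0 ≤ k) (hkT : k = T / N)
    (hn : n < N) :
    volume.restrict (Set.Ioo (n * k) ((n + 1 : ℕ) * k)) ≤ timeMeasure T := by
  refine Measure.restrict_mono (Set.Ioo_subset_Ioo (by positivity) ?_) le_rfl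
  have : T = N * k := by rw [hkT]; field_simp
  rw [this]
  gcongr
  exact_mod_cast hn

theorem map_randomTime_absolutelyContinuous (hτ : IsUniformSequence P τ) {T : ℝ} {N n : ℕ}
    (hN : 0 < N) (hk : 0 < k) (hkT : k = T / N) (hn : n < N) :
    P.map (randomTime k τ n) ≪ timeMeasure T := by
  rw [map_randomTime hτ hk]
  exact (Measure.absolutelyContinuous_of_le
    (restrict_Ioo_le_timeMeasure hN hk.le hkT hn)).smul_left _

/-- The law of ξ is absolutely continuous, so facts known only for almost every t may be used at the
random time. -/
theorem ae_randomTime (hτ : IsUniformSequence P τ) {T : ℝ} {N n : ℕ}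
    (hN : 0 < N) (hk : 0 < k) (hkT : k = T / N) (hn : n < N) {p : ℝ → Prop}
    (h : ∀ᵐ t ∂timeMeasure T, p t) : ∀ᵐ ω ∂P, p (randomTime k τ n ω) :=
  ae_of_ae_map (measurable_randomTime hτ k n).aemeasurable
    ((map_randomTime_absolutelyContinuous hτ hN hk hkT hn).ae_le h)

theorem ae_randomTime_mem (hτ : IsUniformSequence P τ) (hk : 0 < k) (n : ℕ) :
    ∀ᵐ ω ∂P, randomTime k τ n ω ∈ Set.Ioo (n * k) ((n + 1 : ℕ) * k) := by
  have h : ∀ᵐ t ∂P.map (randomTime k τ n), t ∈ Set.Ioo (n * k) ((n + 1 : ℕ) * k) := by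
    rw [map_randomTime hτ hk]
    exact Measure.ae_smul_measure (ae_restrict_mem measurableSet_Ioo) _
  exact ae_of_ae_map (measurable_randomTime hτ k n).aemeasurable h

variable {X : Type*} [NormedAddCommGroup X]

theorem memLp_map_randomTime (hτ : IsUniformSequence P τ) {T : ℝ} {N n : ℕ}
    (hN : 0 < N) (hk : 0 < k) (hkT : k = T / N) (hn : n < N) {g : ℝ → X}
    (hg : MemLp g 2 (timeMeasure T)) : MemLp g 2 (P.map (randomTime k τ n)) := by
  rw [map_randomTime hτ hk]
  exact (hg.mono_measure (restrict_Ioo_le_timeMeasure hN hk.le hkT hn)).smul_measure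
    ENNReal.ofReal_ne_top

theorem memLp_comp_randomTime (hτ : IsUniformSequence P τ) {T : ℝ} {N n : ℕ}
    (hN : 0 < N) (hk : 0 < k) (hkT : k = T / N) (hn : n < N) {g : ℝ → X}
    (hg : MemLp g 2 (timeMeasure T)) : MemLp (fun ω => g (randomTime k τ n ω)) 2 P :=
  (memLp_map_randomTime hτ hN hk hkT hn hg).comp_of_map
    (measurable_randomTime hτ k n).aemeasurable

/-- The density of ξ on its step is 1/k, which makes the one-point random quadrature unbiased. -/
theorem integral_comp_randomTime [NormedSpace ℝ X] (hτ : IsUniformSequence P τ) {T : ℝ} {N n : ℕ}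
    (hN : 0 < N) (hk : 0 < k) (hkT : k = T / N) (hn : n < N) {g : ℝ → X}
    (hg : AEStronglyMeasurable g (timeMeasure T)) :
    k • ∫ ω, g (randomTime k τ n ω) ∂P = ∫ t in n * k..(n + 1 : ℕ) * k, g t := by
  rw [← integral_map (measurable_randomTime hτ k n).aemeasurable
    (hg.mono_ac (map_randomTime_absolutelyContinuous hτ hN hk hkT hn)), map_randomTime hτ hk,
    integral_smul_measure, ENNReal.toReal_ofReal (by positivity), smul_smul,
    mul_inv_cancel₀ hk.ne', one_smul, intervalIntegral.integral_of_le (by gcongr; simp),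
    integral_Ioc_eq_integral_Ioo]

end RandomTime

/-! ### Squares of `L²` norms -/

theorem l2norm_nonneg {α X : Type*} [MeasurableSpace α] [NormedAddCommGroup X] (ν : Measure α)
    (g : α → X) : 0 ≤ l2norm ν g := ENNReal.toReal_nonneg

theorem l2norm_sq {α X : Type*} [MeasurableSpace α] [NormedAddCommGroup X] {ν : Measure α}
    {g : α → X} (hg : MemLp g 2 ν) : l2norm ν g ^ 2 = ∫ a, ‖g a‖ ^ 2 ∂ν := by
  have h0 : 0 ≤ ∫ a, ‖g a‖ ^ 2 ∂ν := integral_nonneg fun _ => by positivity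
  rw [l2norm, hg.eLpNorm_eq_integral_rpow_norm (by norm_num) (by norm_num)]
  simp only [ENNReal.toReal_ofNat, Real.rpow_ofNat]
  rw [ENNReal.toReal_ofReal (by positivity), ← Real.rpow_natCast, ← Real.rpow_mul h0]
  norm_num

theorem integral_norm_sq_timeMeasure_eq_sum {X : Type*} [NormedAddCommGroup X] {T k : ℝ} {N : ℕ}
    (hN : 0 < N) (hk : 0 < k) (hkT : k = T / N) {g : ℝ → X} (hg : MemLp g 2 (timeMeasure T)) :
    ∑ n ∈ Finset.range N, ∫ t in n * k..(n + 1 : ℕ) * k, ‖g t‖ ^ 2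
      = l2norm (timeMeasure T) g ^ 2 := by
  have hT : T = N * k := by rw [hkT]; field_simp
  have hT0 : 0 < T := by rw [hT]; positivity
  have hint : IntegrableOn (fun t => ‖g t‖ ^ 2) (Set.Ioo 0 T) :=
    hg.integrable_norm_pow (by norm_num)
  have hint' : IntegrableOn (fun t => ‖g t‖ ^ 2) (Set.Icc 0 T) := by
    rwa [integrableOn_Icc_iff_integrableOn_Ioo]
  rw [l2norm_sq hg, intervalIntegral.sum_integral_adjacent_intervals (a := fun n : ℕ => n * k)
    (f := fun t => ‖g t‖ ^ 2)]
  · simp only [Nat.cast_zero, zero_mul]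
    rw [← hT, intervalIntegral.integral_of_le hT0.le, integral_Ioc_eq_integral_Ioo, timeMeasure]
  · intro n hn
    refine (hint'.mono_set ?_).intervalIntegrable
    rw [Set.uIcc_of_le (by gcongr; simp), hT]
    refine Set.Icc_subset_Icc (by positivity) ?_
    gcongr
    exact_mod_cast hn

/-! ### Weak derivatives -/

/-- A smooth function with compact support in `(0, T)` and vanishing integral is the derivative of
such a function. -/
theorem exists_primitive_of_integral_eq_zero {T : ℝ} {χ : ℝ → ℝ}
    (hχ : ContDiff ℝ (⊤ : ℕ∞) χ) (hc : HasCompactSupport χ) (hs : tsupport χ ⊆ Set.Ioo 0 T)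
    (h0 : ∫ t, χ t = 0) :
    ∃ φ : ℝ → ℝ, ContDiff ℝ (⊤ : ℕ∞) φ ∧ HasCompactSupport φ ∧ tsupport φ ⊆ Set.Ioo 0 T ∧
      deriv φ = χ := by
  have hcont := hχ.continuous
  have hi : Integrable χ := hcont.integrable_of_hasCompactSupport hc
  have hd : ∀ x, HasDerivAt (fun x => ∫ t in (0 : ℝ)..x, χ t) (χ x) x := fun x =>
    intervalIntegral.integral_hasDerivAt_right (hcont.intervalIntegrable _ _)
      hcont.stronglyMeasurable.stronglyMeasurableAtFilter hcont.continuousAt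
  have hder : deriv (fun x => ∫ t in (0 : ℝ)..x, χ t) = χ := funext fun x => (hd x).deriv
  have hsm : ContDiff ℝ (⊤ : ℕ∞) (fun x => ∫ t in (0 : ℝ)..x, χ t) := by
    rw [contDiff_infty_iff_deriv]
    exact ⟨fun x => (hd x).differentiableAt, by rw [hder]; exact hχ⟩
  obtain ⟨a, b, hab, hsub⟩ : ∃ a b, Set.Icc a b ⊆ Set.Ioo 0 T ∧ tsupport χ ⊆ Set.Icc a b := by
    rcases (tsupport χ).eq_empty_or_nonempty with he | hne
    -- For empty support the interval [1, 0], which is empty, serves.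
    · exact ⟨1, 0, by simp, by simp [he]⟩
    · exact ⟨sInf (tsupport χ), sSup (tsupport χ),
        fun x hx => ⟨(hs (hc.isCompact.sInf_mem hne)).1.trans_le hx.1,
          hx.2.trans_lt (hs (hc.isCompact.sSup_mem hne)).2⟩,
        fun x hx => ⟨csInf_le hc.isCompact.bddBelow hx, le_csSup hc.isCompact.bddAbove hx⟩⟩
  have hz : ∀ x, x ∉ Set.Icc a b → χ x = 0 := fun x hx =>
    image_eq_zero_of_notMem_tsupport fun h => hx (hsub h)
  have h0' : ∀ x, x ∉ Set.Ioo 0 T → χ x = 0 := fun x hx => hz x fun h => hx (hab h)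
  -- To the left of a nothing has been integrated yet; to the right of b the whole integral of χ has
  -- been, and it is zero.
  have hzero : ∀ x, x ∉ Set.Icc a b → ∫ t in (0 : ℝ)..x, χ t = 0 := by
    intro x hx
    rcases lt_or_ge x a with hxa | hxa
    · have e1 : ∫ t in Set.Iic x, χ t = 0 := setIntegral_eq_zero_of_forall_eq_zero fun t ht =>
        hz t fun h => by linarith [h.1, Set.mem_Iic.1 ht]
      have e2 : ∫ t in Set.Iic (0:ℝ), χ t = 0 := setIntegral_eq_zero_of_forall_eq_zero fun t ht =>
        h0' t fun h => by linarith [h.1, Set.mem_Iic.1 ht]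
      rw [← intervalIntegral.integral_Iic_sub_Iic hi.integrableOn hi.integrableOn, e1, e2, sub_zero]
    · have hxb : b < x := by by_contra h; exact hx ⟨hxa, not_lt.1 h⟩
      have e1 : ∫ t in Set.Ioi x, χ t = 0 := setIntegral_eq_zero_of_forall_eq_zero fun t ht =>
        hz t fun h => by linarith [h.2, Set.mem_Ioi.1 ht]
      have e2 : ∫ t in Set.Iic (0:ℝ), χ t = 0 := setIntegral_eq_zero_of_forall_eq_zero fun t ht =>
        h0' t fun h => by linarith [h.1, Set.mem_Iic.1 ht]
      have e3 := intervalIntegral.integral_Iic_add_Ioi (b := x) hi.integrableOn hi.integrableOn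
      rw [← intervalIntegral.integral_Iic_sub_Iic hi.integrableOn hi.integrableOn, e2]
      linarith
  have hts : tsupport (fun x => ∫ t in (0 : ℝ)..x, χ t) ⊆ Set.Icc a b :=
    closure_minimal (fun x hx => by by_contra h; exact hx (hzero x h)) isClosed_Icc
  exact ⟨_, hsm, isCompact_Icc.of_isClosed_subset (isClosed_tsupport _) hts, hts.trans hab, hder⟩

/-- The du Bois-Reymond lemma. -/
theorem eq_const_of_integral_deriv_mul_eq_zero {T : ℝ} (hT : 0 < T) {q : ℝ → ℝ}
    (hq : ContinuousOn q (Set.Icc 0 T))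
    (h : ∀ φ : ℝ → ℝ, ContDiff ℝ (⊤ : ℕ∞) φ → HasCompactSupport φ → tsupport φ ⊆ Set.Ioo 0 T →
      ∫ t in Set.Ioo 0 T, deriv φ t * q t = 0) :
    ∀ t ∈ Set.Icc 0 T, q t = q 0 := by
  obtain ⟨ψ₀, hψ₀, hψ₀c, hψ₀s, hψ₀1⟩ : ∃ ψ₀ : ℝ → ℝ, ContDiff ℝ (⊤ : ℕ∞) ψ₀ ∧
      HasCompactSupport ψ₀ ∧ tsupport ψ₀ ⊆ Set.Ioo 0 T ∧ ∫ t, ψ₀ t = 1 := by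
    let b : ContDiffBump (T / 2) := ⟨T / 8, T / 4, by positivity, by linarith⟩
    refine ⟨b.normed volume, b.contDiff_normed, b.hasCompactSupport_normed, ?_, b.integral_normed⟩
    rw [b.tsupport_normed_eq, Real.closedBall_eq_Icc]
    intro x hx
    have h1 : b.rOut = T / 4 := rfl
    rw [h1] at hx
    constructor <;> linarith [hx.1, hx.2]
  have hI : ∀ ψ : ℝ → ℝ, Continuous ψ → IntegrableOn (fun t => ψ t * q t) (Set.Ioo 0 T) :=
    fun ψ hψ => ((hψ.continuousOn.mul hq).integrableOn_Icc).mono_set Set.Ioo_subset_Icc_self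
  set c := ∫ t in Set.Ioo 0 T, ψ₀ t * q t with hc
  have hae : ∀ᵐ t, t ∈ Set.Ioo 0 T → q t - c = 0 := by
    refine isOpen_Ioo.ae_eq_zero_of_integral_contDiff_smul_eq_zero
      (((hq.sub continuousOn_const).mono Set.Ioo_subset_Icc_self).locallyIntegrableOn
        measurableSet_Ioo) fun ψ hψ hψc hψs => ?_
    have hψi := hψ.continuous.integrable_of_hasCompactSupport hψc (μ := volume)
    have hψ₀i := hψ₀.continuous.integrable_of_hasCompactSupport hψ₀c (μ := volume)
    -- Removing (∫ ψ) ψ₀ makes the integral vanish, so the hypothesis applies to the primitive and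
    -- gives ∫ ψ q = (∫ ψ) c, with c the ψ₀-mean of q.
    obtain ⟨φ, h1, h2, h3, h4⟩ := exists_primitive_of_integral_eq_zero
      (T := T) (χ := fun t => ψ t - (∫ t, ψ t) * ψ₀ t) (hψ.sub (contDiff_const.mul hψ₀))
      (hψc.sub (hψ₀c.mul_left))
      ((tsupport_sub _ _).trans (Set.union_subset hψs ((tsupport_mul_subset_right).trans hψ₀s)))
      (by rw [integral_sub hψi (hψ₀i.const_mul _), integral_const_mul, hψ₀1, mul_one, sub_self])
    have h5 := h φ h1 h2 h3
    rw [h4] at h5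
    have h6 : ∫ t in Set.Ioo 0 T, ψ t * q t = (∫ t, ψ t) * c := by
      have : (fun t => (ψ t - (∫ t, ψ t) * ψ₀ t) * q t)
        = fun t => ψ t * q t - (∫ t, ψ t) * (ψ₀ t * q t) := by funext t; ring
      rw [this, integral_sub (hI _ hψ.continuous) ((hI _ hψ₀.continuous).const_mul _),
        integral_const_mul] at h5
      linarith
    have hout : ∀ t, t ∉ Set.Ioo 0 T → ψ t = 0 := fun t ht =>
      image_eq_zero_of_notMem_tsupport fun h => ht (hψs h)
    have h7 : ∫ t in Set.Ioo 0 T, ψ t = ∫ t, ψ t :=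
      setIntegral_eq_integral_of_forall_compl_eq_zero hout
    rw [← setIntegral_eq_integral_of_forall_compl_eq_zero (s := Set.Ioo 0 T)
      fun t ht => by rw [hout t ht, zero_smul]]
    simp only [smul_eq_mul, mul_sub]
    rw [integral_sub (hI _ hψ.continuous) (hψi.integrableOn.mul_const _), integral_mul_const, h6,
      h7, sub_self]
  have hIcc : (q : ℝ → ℝ) =ᵐ[volume.restrict (Set.Icc 0 T)] fun _ => c := by
    rw [Filter.EventuallyEq, ← restrict_Ioo_eq_restrict_Icc, ae_restrict_iff' measurableSet_Ioo]
    filter_upwards [hae] with t ht h using sub_eq_zero.1 (ht h)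
  have := Measure.eqOn_Icc_of_ae_eq volume hT.ne hIcc hq continuousOn_const
  intro t ht
  rw [this ht, this (Set.left_mem_Icc.2 hT.le)]

/-- A continuous function on `[0, T]` whose weak derivative is integrable is an integral of its
weak derivative. -/
theorem eq_add_integral_of_weak_deriv {T : ℝ} (hT : 0 < T) {p g : ℝ → ℝ}
    (hp : ContinuousOn p (Set.Icc 0 T)) (hg : IntegrableOn g (Set.Ioo 0 T))
    (h : ∀ φ : ℝ → ℝ, ContDiff ℝ (⊤ : ℕ∞) φ → HasCompactSupport φ → tsupport φ ⊆ Set.Ioo 0 T →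
      ∫ t in Set.Ioo 0 T, deriv φ t * p t = -∫ t in Set.Ioo 0 T, φ t * g t) :
    ∀ t ∈ Set.Icc 0 T, p t = p 0 + ∫ s in (0 : ℝ)..t, g s := by
  have hgi : IntervalIntegrable g volume 0 T := by
    rwa [intervalIntegrable_iff_integrableOn_Ioo_of_le hT.le]
  have hG := hgi.absolutelyContinuousOnInterval_intervalIntegral (c := 0) (by simp)
  have hGc : ContinuousOn (fun x => ∫ s in (0 : ℝ)..x, g s) (Set.Icc 0 T) := by
    have := hG.continuousOn
    rwa [Set.uIcc_of_le hT.le] at this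
  have key := eq_const_of_integral_deriv_mul_eq_zero hT
    (q := fun t => p t - ∫ s in (0 : ℝ)..t, g s) (hp.sub hGc) fun φ h1 h2 h3 => by
    have hφ' : Continuous (deriv φ) := h1.continuous_deriv (by simp)
    have hI : ∀ q : ℝ → ℝ, ContinuousOn q (Set.Icc 0 T) →
        IntegrableOn (fun t => deriv φ t * q t) (Set.Ioo 0 T) := fun q hq =>
      ((hφ'.continuousOn.mul hq).integrableOn_Icc).mono_set Set.Ioo_subset_Icc_self
    have hφac : AbsolutelyContinuousOnInterval φ 0 T :=
      (h1.of_le (by simp)).contDiffOn.absolutelyContinuousOnInterval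
    have hout : ∀ t, t ∉ Set.Ioo 0 T → φ t = 0 := fun t ht =>
      image_eq_zero_of_notMem_tsupport fun h => ht (h3 h)
    -- Integration by parts for absolutely continuous functions shows that p − ∫ g has zero weak
    -- derivative; the boundary terms vanish with φ.
    have hibp := hφac.integral_mul_deriv_eq_deriv_mul hG
    rw [hout 0 (by simp), hout T (by simp), zero_mul, zero_mul, sub_zero, zero_sub] at hibp
    have e1 : ∫ x in (0 : ℝ)..T, φ x * deriv (fun x => ∫ s in (0 : ℝ)..x, g s) x
        = ∫ x in (0 : ℝ)..T, φ x * g x := by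
      refine intervalIntegral.integral_congr_ae ?_
      filter_upwards [hgi.ae_hasDerivAt_integral] with x hx hx2
      rw [(hx (Set.uIoc_subset_uIcc hx2) 0 (by simp)).deriv]
    rw [e1, intervalIntegral.integral_of_le hT.le, intervalIntegral.integral_of_le hT.le,
      integral_Ioc_eq_integral_Ioo, integral_Ioc_eq_integral_Ioo] at hibp
    simp only [mul_sub]
    rw [integral_sub (hI _ hp) (hI _ hGc), h φ h1 h2 h3, hibp]
    ring
  intro t ht
  have := key t ht
  simp only [intervalIntegral.integral_same, sub_zero] at this
  linarith

/-! ### The evolution equation in integral form -/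

section Evolution

variable {V H : Type*}
  [NormedAddCommGroup V] [InnerProductSpace ℝ V]
  [NormedAddCommGroup H] [InnerProductSpace ℝ H]

instance isFiniteMeasure_timeMeasure (T : ℝ) : IsFiniteMeasure (timeMeasure T) := by
  unfold timeMeasure; infer_instance

theorem toDualV_apply (ι : V →L[ℝ] H) (g : H) (v : V) : toDualV ι g v = inner ℝ g (ι v) := rfl

theorem continuous_toDualV (ι : V →L[ℝ] H) : Continuous (toDualV ι) := by
  unfold toDualV; fun_prop

theorem MemHolderSpace.norm_sub_le {X : Type*} [NormedAddCommGroup X] {T : ℝ} {γ : NNReal}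
    {u : ℝ → X} (hu : MemHolderSpace T γ u) {s t : ℝ} (hs : s ∈ Set.Icc 0 T)
    (ht : t ∈ Set.Icc 0 T) : ‖u s - u t‖ ≤ holderSpaceNorm T γ u * |s - t| ^ (γ : ℝ) := by
  have h := (MemHolder.holderWith hu).dist_le ⟨s, hs⟩ ⟨t, ht⟩
  rw [dist_eq_norm, Subtype.dist_eq, Real.dist_eq] at h
  refine h.trans ?_
  gcongr
  exact le_add_of_nonneg_left (Real.iSup_nonneg fun _ => norm_nonneg _)

theorem holderSpaceNorm_nonneg {X : Type*} [NormedAddCommGroup X] (T : ℝ) (γ : NNReal)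
    (u : ℝ → X) : 0 ≤ holderSpaceNorm T γ u :=
  add_nonneg (Real.iSup_nonneg fun _ => norm_nonneg _) (NNReal.coe_nonneg _)

theorem MemHolderSpace.continuousOn {X : Type*} [NormedAddCommGroup X] {T : ℝ} {γ : NNReal}
    {u : ℝ → X} (hu : MemHolderSpace T γ u) (hγ : 0 < γ) : ContinuousOn u (Set.Icc 0 T) :=
  continuousOn_iff_continuous_domRestrict.2 ((MemHolder.holderWith hu).continuous hγ)

variable {ι : V →L[ℝ] H} {T : ℝ} {A : ℝ → V → StrongDual ℝ V} {f Au : ℝ → H} {u₀ : V} {u : ℝ → V}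

/-- A continuous weak solution attains its initial value. -/
theorem IsWeakSolution.apply_zero (hT : 0 < T) (hι : Function.Injective ι)
    (hu : IsWeakSolution ι T A f (ι u₀) u) (huc : ContinuousOn u (Set.Icc 0 T)) : u 0 = u₀ := by
  obtain ⟨c, hc, hae, hc0⟩ := hu.initial
  have h1 : (fun t => ι (u t)) =ᵐ[volume.restrict (Set.Icc 0 T)] c := by
    rw [Filter.EventuallyEq, ← restrict_Ioo_eq_restrict_Icc]; exact hae
  have := Measure.eqOn_Icc_of_ae_eq volume hT.ne h1 (ι.continuous.comp_continuousOn huc) hc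
  exact hι ((this (Set.left_mem_Icc.2 hT.le)).trans hc0)

/-- The weak formulation, tested with `φ(t) v`. -/
theorem IsWeakSolution.integral_deriv_mul_inner
    (hu : IsWeakSolution ι T A f (ι u₀) u) (huc : ContinuousOn u (Set.Icc 0 T))
    (hf : MemLp f 2 (timeMeasure T)) (hAu : MemLp Au 2 (timeMeasure T))
    (hA : ∀ᵐ t ∂timeMeasure T, toDualV ι (Au t) = A t (u t)) (v : V) {φ : ℝ → ℝ}
    (h1 : ContDiff ℝ (⊤ : ℕ∞) φ) (h2 : HasCompactSupport φ) (h3 : tsupport φ ⊆ Set.Ioo 0 T) :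
    ∫ t in Set.Ioo 0 T, deriv φ t * inner ℝ (ι (u t)) (ι v)
      = -∫ t in Set.Ioo 0 T, φ t * inner ℝ (f t - Au t) (ι v) := by
  obtain ⟨u', hu', hw, heq⟩ := hu.weak_eq
  have hφ' : Continuous (deriv φ) := h1.continuous_deriv (by simp)
  have hi1 : Integrable (fun t => deriv φ t • toDualV ι (ι (u t))) (timeMeasure T) :=
    ((hφ'.continuousOn.smul ((continuous_toDualV ι).comp_continuousOn
      (ι.continuous.comp_continuousOn huc))).integrableOn_Icc).mono_set Set.Ioo_subset_Icc_self
  obtain ⟨K, hK⟩ := h2.exists_bound_of_continuous h1.continuous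
  have hi2 : Integrable (fun t => φ t • u' t) (timeMeasure T) :=
    (hu'.integrable (by norm_num)).bdd_smul K h1.continuous.aestronglyMeasurable
      (Eventually.of_forall hK)
  have key := congrArg (fun ψ : StrongDual ℝ V => ψ v) (hw φ h1 h2 h3)
  simp only [_root_.neg_apply] at key
  rw [ContinuousLinearMap.integral_apply hi1, ContinuousLinearMap.integral_apply hi2] at key
  simp only [_root_.smul_apply, toDualV_apply, smul_eq_mul] at key
  refine key.trans ?_
  congr 1
  have hfi : Integrable (fun t => inner ℝ (f t) (ι v)) (timeMeasure T) :=
    (hf.integrable (by norm_num)).inner_const _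
  have hAi : Integrable (fun t => inner ℝ (Au t) (ι v)) (timeMeasure T) :=
    (hAu.integrable (by norm_num)).inner_const _
  have hui : Integrable (fun t => u' t v) (timeMeasure T) :=
    (ContinuousLinearMap.apply ℝ ℝ v).integrable_comp (hu'.integrable (by norm_num))
  -- Testing with 1_s v for all measurable s localizes the weak equation in time. The null set may
  -- depend on v, which is fixed here.
  have hae : (fun t => u' t v + inner ℝ (Au t) (ι v)) =ᵐ[timeMeasure T]
      fun t => inner ℝ (f t) (ι v) := by
    refine Integrable.ae_eq_of_forall_setIntegral_eq _ _ (hui.add hAi) hfi fun s hs _ => ?_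
    have := heq (s.indicator fun _ => v) ((memLp_const v).indicator hs)
    have e1 : ∀ᵐ t ∂timeMeasure T, (u' t + A t (u t)) (s.indicator (fun _ => v) t)
        = s.indicator (fun t => u' t v + inner ℝ (Au t) (ι v)) t := by
      filter_upwards [hA] with t ht
      by_cases hts : t ∈ s
      · simp [hts, ← ht, toDualV_apply]
      · simp [hts]
    have e2 : ∀ t, (toDualV ι (f t)) (s.indicator (fun _ => v) t)
        = s.indicator (fun t => inner ℝ (f t) (ι v)) t := fun t => by
      by_cases hts : t ∈ s <;> simp [hts, toDualV_apply]
    rw [integral_congr_ae e1, integral_indicator hs] at this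
    simp only [e2] at this
    rwa [integral_indicator hs] at this
  refine integral_congr_ae ?_
  filter_upwards [hae] with t ht
  rw [inner_sub_left, ← ht, add_sub_cancel_right]

/-- The evolution equation in integral form, with values in `H`. -/
theorem IsWeakSolution.sub_eq_integral [CompleteSpace H] (hT : 0 < T) (hd : DenseRange ι)
    (hu : IsWeakSolution ι T A f (ι u₀) u) (huc : ContinuousOn u (Set.Icc 0 T))
    (hf : MemLp f 2 (timeMeasure T)) (hAu : MemLp Au 2 (timeMeasure T))
    (hA : ∀ᵐ t ∂timeMeasure T, toDualV ι (Au t) = A t (u t)) {s t : ℝ} (hs : s ∈ Set.Icc 0 T)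
    (ht : t ∈ Set.Icc 0 T) :
    ι (u t) - ι (u s) = ∫ r in s..t, (f r - Au r) := by
  have hg : IntegrableOn (fun r => f r - Au r) (Set.Ioo 0 T) :=
    (hf.sub hAu).integrable (by norm_num)
  have hgi : ∀ a ∈ Set.Icc 0 T, ∀ b ∈ Set.Icc 0 T,
      IntervalIntegrable (fun r => f r - Au r) volume a b := fun a ha b hb => by
    rw [← integrableOn_Icc_iff_integrableOn_Ioo] at hg
    exact (hg.mono_set (Set.uIcc_subset_Icc ha hb)).intervalIntegrable
  have h0 : (0 : ℝ) ∈ Set.Icc 0 T := Set.left_mem_Icc.2 hT.le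
  have key : ∀ b ∈ Set.Icc 0 T, ι (u b) = ι (u 0) + ∫ r in (0 : ℝ)..b, (f r - Au r) := by
    intro b hb
    -- The range of ι is dense, so the identity in H follows from its scalar versions against ι v.
    refine hd.eq_of_inner_left ℝ fun v => ?_
    have := eq_add_integral_of_weak_deriv hT (p := fun t => inner ℝ (ι (u t)) (ι v))
      (g := fun t => inner ℝ (f t - Au t) (ι v))
      ((ι.continuous.comp_continuousOn huc).inner continuousOn_const) (hg.inner_const _)
      (fun φ h1 h2 h3 => hu.integral_deriv_mul_inner huc hf hAu hA v h1 h2 h3) b hb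
    rw [this, inner_add_left]
    congr 1
    rw [real_inner_comm, intervalIntegral.integral_of_le hb.1, intervalIntegral.integral_of_le hb.1,
      ← integral_inner ((hgi 0 h0 b hb).1)]
    exact integral_congr_ae (Eventually.of_forall fun x => real_inner_comm _ _)
  rw [key t ht, key s hs, add_sub_add_left_eq_sub]
  exact intervalIntegral.integral_interval_sub_left (hgi 0 h0 t ht) (hgi 0 h0 s hs)

end Evolution

/-! ### Solvability and measurability of the scheme -/

section Scheme

variable {V H : Type*}
  [NormedAddCommGroup V] [InnerProductSpace ℝ V]
  [NormedAddCommGroup H] [InnerProductSpace ℝ H]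
  {ι : V →L[ℝ] H} {hι : Function.Injective ι} {W : Submodule ℝ V} [FiniteDimensional ℝ W]
  {T M L μ k : ℝ} {A : ℝ → V → StrongDual ℝ V} {f : ℝ → H}

theorem inner_discreteOp (t : ℝ) (v w : W) :
    inner ℝ (ι (discreteOp ι hι W A t v : V)) (ι w) = A t v w :=
  inner_galerkinRiesz ι hι W _ w

/-- One step of the scheme, `w + k A_h(t) w = k P_h f(t) + b`, is uniquely solvable for almost
every `t`; its solution is a measurable function of `(t, b)` with linear growth. -/
theorem exists_measurable_step [MeasurableSpace W] [BorelSpace W] (hk : 0 < k) (hμ : 0 < μ)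
    (hL : 0 < L) (hA : IsMonotoneFamily T M L μ A) (hf : MemLp f 2 (timeMeasure T)) :
    ∃ S : ℝ × W → W, Measurable S ∧ ∃ K : ℝ, 0 ≤ K ∧ ∀ᵐ t ∂timeMeasure T, ∀ b w : W,
      (w + k • discreteOp ι hι W A t w = k • galerkinProj ι hι W (f t) + b ↔ w = S (t, b)) ∧
      ‖S (t, b)‖ ≤ K * (‖f t‖ + ‖b‖ + 1) := by
  -- A_h is monotone for the inner product of H, while W carries that of V; the step is therefore
  -- solved on the image of W in H. The norm comparison constant c depends on W but enters only
  -- solvability and integrability, not the error constant.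
  let E := W.map (ι : V →ₗ[ℝ] H)
  let e : W ≃L[ℝ] E := (imageEquiv ι hι W).toContinuousLinearEquiv
  let _ : MeasurableSpace E := borel E
  have : BorelSpace E := ⟨rfl⟩
  obtain ⟨c, hc0, hc⟩ : ∃ c : ℝ, 0 ≤ c ∧ ∀ x : E, ‖e.symm x‖ ≤ c * ‖x‖ :=
    ⟨‖(e.symm : E →L[ℝ] W)‖, ContinuousLinearMap.opNorm_nonneg _, (e.symm : E →L[ℝ] W).le_opNorm⟩
  have he : ∀ w : W, ‖e w‖ ≤ ‖ι‖ * ‖w‖ := fun w => ι.le_opNorm w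
  let B : ℝ → E → E := fun t x => e (discreteOp ι hι W A t (e.symm x))
  have hBin : ∀ t x y, (inner ℝ (B t x) y : ℝ) = A t (e.symm x) (e.symm y) := fun t x y => by
    rw [← inner_discreteOp (hι := hι) t (e.symm x) (e.symm y)]
    conv_lhs => rw [← e.apply_symm_apply y]
    rfl
  have hBsub : ∀ t x y z, (inner ℝ (B t x - B t y) z : ℝ)
      = (A t (e.symm x) - A t (e.symm y)) (e.symm z) := fun t x y z => by
    rw [inner_sub_left, hBin, hBin]; rfl
  have hdual : ∀ (ψ : StrongDual ℝ V) (z : E) (r : ℝ), ‖ψ‖ ≤ r → inner ℝ z z = ψ (e.symm z) →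
      ‖z‖ ≤ r * c := fun ψ z r hr hz => by
    have h1 : ‖z‖ * ‖z‖ ≤ r * c * ‖z‖ := by
      rw [← real_inner_self_eq_norm_mul_norm, hz, mul_assoc]
      refine (Real.le_norm_self _).trans ((ψ.le_opNorm _).trans ?_)
      have := hc z
      rw [Submodule.norm_coe]
      gcongr
      exact (norm_nonneg _).trans hr
    rcases (norm_nonneg z).eq_or_lt with h0 | h0
    · rw [← h0]; exact mul_nonneg ((norm_nonneg _).trans hr) hc0
    · exact le_of_mul_le_mul_right h1 h0
  have hBl : ∀ t ∈ Set.Icc 0 T, ∀ x y, ‖B t x - B t y‖ ≤ L * c * c * ‖x - y‖ :=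
    fun t ht x y => by
      have h1 := hdual (A t (e.symm x) - A t (e.symm y)) (B t x - B t y) (L * (c * ‖x - y‖))
        ((hA.lipschitz t ht _ _).trans (by
          have := hc (x - y)
          rw [map_sub] at this
          gcongr
          exact this)) (hBsub t x y _)
      linarith
  have hBm : ∀ t ∈ Set.Icc 0 T, ∀ x y, 0 ≤ (inner ℝ (B t x - B t y) (x - y) : ℝ) :=
    fun t ht x y => by
      rw [hBsub, map_sub]
      exact le_trans (by positivity) (hA.strongly_monotone t ht (e.symm x) (e.symm y))
  have hae : ∀ᵐ t ∂timeMeasure T, t ∈ Set.Icc 0 T :=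
    (ae_restrict_mem measurableSet_Ioo).mono fun t ht => Set.Ioo_subset_Icc_self ht
  -- Nothing is known of A outside [0, T]. The zero map there keeps every member of the family
  -- monotone and Lipschitz, as the resolvent lemma requires for all parameters.
  have hmod := exists_measurable_modification (ν := timeMeasure T) (B := fun t x => if t ∈
      Set.Icc 0 T then B t x else 0) (K := L * c * c)
    (fun x y => (hA.measurable (e.symm x) (e.symm y)).congr (by
      filter_upwards [hae] with t ht
      rw [if_pos ht, hBin]))
    (by filter_upwards [hae] with t ht; simpa only [ht, if_true] using hBl t ht)
  obtain ⟨B', hB'm, hB'ae, hB'⟩ := hmod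
  have hB'l : ∀ t x y, ‖B' t x - B' t y‖ ≤ L * c * c * ‖x - y‖ := fun t x y => by
    rcases hB' t with h | ⟨h, h'⟩
    · rw [h]; simp; positivity
    · rw [h]; exact h' x y
  have hB'mon : ∀ t x y, 0 ≤ (inner ℝ (B' t x - B' t y) (x - y) : ℝ) := fun t x y => by
    rcases hB' t with h | ⟨h, -⟩
    · rw [h]; simp
    · rw [h]
      by_cases ht : t ∈ Set.Icc 0 T
      · simpa only [ht, if_true] using hBm t ht x y
      · simp only [ht, if_false]; simp
  have hGm : ∀ t x y, ‖x - y‖ ^ 2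
      ≤ (inner ℝ ((x + k • B' t x) - (y + k • B' t y)) (x - y) : ℝ) := fun t x y => by
    rw [add_sub_add_comm, ← smul_sub, inner_add_left, inner_smul_left,
      real_inner_self_eq_norm_sq]
    exact le_add_of_nonneg_right (mul_nonneg hk.le (hB'mon t x y))
  obtain ⟨R, hRm, hR⟩ := exists_measurable_resolvent (E := E) (G := fun t x => x + k • B' t x)
    (K := 1 + k * (L * c * c)) (measurable_snd.add (hB'm.const_smul k))
    (le_add_of_nonneg_right (by positivity))
    (fun t x y => by
      rw [add_sub_add_comm, ← smul_sub, add_mul, one_mul]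
      refine (norm_add_le _ _).trans ?_
      rw [norm_smul, Real.norm_of_nonneg hk.le, mul_assoc k]
      gcongr
      exact hB'l t x y) hGm
  -- Since f is only almost everywhere measurable, the solution map is built from a measurable
  -- representative.
  let f₁ : ℝ → E := fun t => E.orthogonalProjectionOnto (hf.1.mk f t)
  have hf₁ : Measurable f₁ :=
    (E.orthogonalProjectionOnto.continuous.comp_stronglyMeasurable
      hf.1.stronglyMeasurable_mk).measurable
  have heP : ∀ g, e (galerkinProj ι hι W g) = E.orthogonalProjectionOnto g := fun g =>
    e.apply_symm_apply _
  -- The maximum with 0 is needed because 0 ≤ M is known only once a time in [0, T] is given.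
  refine ⟨fun p => e.symm (R (p.1, k • f₁ p.1 + e p.2)), ?_, c * (k + ‖ι‖ + k * (M * c)) ⊔ 0,
    le_max_right _ _, ?_⟩
  · exact e.symm.continuous.measurable.comp (hRm.comp (measurable_fst.prodMk
      (((hf₁.comp measurable_fst).const_smul k).add (e.continuous.measurable.comp measurable_snd))))
  filter_upwards [hae, hB'ae, hf.1.ae_eq_mk] with t ht htB htf b w
  have hBt : B' t = B t := by rw [htB]; simp only [ht, if_true]
  have hg : k • f₁ t + e b = e (k • galerkinProj ι hι W (f t) + b) := by
    rw [map_add, map_smul, heP, htf]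
  constructor
  · rw [← e.injective.eq_iff, ← hg, e.eq_symm_apply]
    have hGw : e (w + k • discreteOp ι hι W A t w) = e w + k • B' t (e w) := by
      rw [hBt, map_add, map_smul]
      simp only [B, e.symm_apply_apply]
    rw [hGw]
    constructor
    · intro h
      have h2 := norm_sub_le_of_monotone (hGm t) (e w) (R (t, k • f₁ t + e b))
      rw [h, hR t, sub_self, norm_zero] at h2
      exact sub_eq_zero.1 (norm_le_zero_iff.1 h2)
    · intro h
      rw [h]
      exact hR t _
  -- Linear growth comes from comparing the solution with 0, whose image is k B'(t) 0.
  · have h2 := norm_sub_le_of_monotone (hGm t) (R (t, k • f₁ t + e b)) 0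
    rw [hR t, sub_zero, zero_add] at h2
    have hz : ‖B' t 0‖ ≤ M * c := by
      rw [hBt]
      have h0 := hBin t 0 (B t 0)
      rw [map_zero] at h0
      exact hdual (A t 0) _ M (hA.bound_zero t ht) h0
    have hM : 0 ≤ M := (norm_nonneg _).trans (hA.bound_zero t ht)
    have hf₁n : ‖f₁ t‖ ≤ ‖f t‖ := by
      simp only [f₁, ← htf]
      exact E.norm_orthogonalProjectionOnto_apply_le _
    refine le_trans ?_ (mul_le_mul_of_nonneg_right (le_max_left _ _) (by positivity))
    calc ‖e.symm (R (t, k • f₁ t + e b))‖ ≤ c * ‖R (t, k • f₁ t + e b)‖ := hc _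
      _ ≤ c * (k * ‖f t‖ + ‖ι‖ * ‖b‖ + k * (M * c)) := by
        gcongr
        refine h2.trans ((norm_sub_le _ _).trans ?_)
        rw [norm_smul, Real.norm_of_nonneg hk.le]
        refine add_le_add ((norm_add_le _ _).trans ?_) (by gcongr)
        rw [norm_smul, Real.norm_of_nonneg hk.le]
        gcongr
        exact he b
      _ ≤ _ := by
        rw [mul_assoc]
        gcongr
        have h1 : 0 ≤ ‖ι‖ * (‖f t‖ + 1) := by positivity
        have h2 : 0 ≤ k * (‖b‖ + 1) := by positivity
        have h3 : 0 ≤ k * (M * c) * (‖f t‖ + ‖b‖) := by positivity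
        linarith

variable {Ω : Type*} [MeasurableSpace Ω] {P : Measure Ω} {τ : ℕ → Ω → ℝ} {N : ℕ}

theorem exists_isSchemeSolution (hτ : IsUniformSequence P τ) (hμ : 0 < μ) (hL : 0 < L)
    (hN : 0 < N) (hk : 0 < k) (hkT : k = T / N) (hA : IsMonotoneFamily T M L μ A)
    (hf : MemLp f 2 (timeMeasure T)) (u₀ : H) :
    ∃ U : ℕ → Ω → W, IsSchemeSolution P τ ι hι W A f u₀ k N U := by
  let _ : MeasurableSpace W := borel W
  have : BorelSpace W := ⟨rfl⟩
  obtain ⟨S, -, K, -, hS⟩ := exists_measurable_step (ι := ι) (hι := hι) (W := W) hk hμ hL hA hf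
  refine ⟨fun n ω => Nat.rec (galerkinProj ι hι W u₀) (fun n w => S (randomTime k τ n ω, w)) n,
    ae_of_all _ fun ω => rfl, ?_⟩
  have : ∀ n, ∀ᵐ ω ∂P, n < N → ∀ b w : W,
      w + k • discreteOp ι hι W A (randomTime k τ n ω) w
        = k • galerkinProj ι hι W (f (randomTime k τ n ω)) + b ↔ w = S (randomTime k τ n ω, b) := by
    intro n
    by_cases hn : n < N
    · filter_upwards [ae_randomTime hτ hN hk hkT hn hS] with ω hω _ b w using (hω b w).1
    · exact ae_of_all _ fun ω h => absurd h hn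
  filter_upwards [ae_all_iff.2 this] with ω hω n hn
  exact (hω n hn _ _).2 rfl

/-- The `n`-th iterate of the scheme is square integrable and, almost surely, a function of the
first `n` random variables. -/
theorem IsSchemeSolution.memLp_and_eq_comp [IsProbabilityMeasure P] [MeasurableSpace W]
    [BorelSpace W] (hτ : IsUniformSequence P τ) (hμ : 0 < μ) (hL : 0 < L)
    (hN : 0 < N) (hk : 0 < k) (hkT : k = T / N) (hA : IsMonotoneFamily T M L μ A)
    (hf : MemLp f 2 (timeMeasure T)) {u₀ : H} {U : ℕ → Ω → W}
    (hU : IsSchemeSolution P τ ι hι W A f u₀ k N U) {n : ℕ} (hn : n ≤ N) :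
    MemLp (U n) 2 P ∧ ∃ Ψ : (Finset.range n → ℝ) → W, Measurable Ψ ∧
      U n =ᵐ[P] fun ω => Ψ fun i => τ i ω := by
  obtain ⟨S, hSm, K, hK, hS⟩ :=
    exists_measurable_step (ι := ι) (hι := hι) (W := W) hk hμ hL hA hf
  induction n with
  | zero =>
    exact ⟨(memLp_const _).ae_eq (EventuallyEq.symm hU.initial),
      fun _ => galerkinProj ι hι W u₀, measurable_const, hU.initial⟩
  | succ n ih =>
    obtain ⟨hp, Ψ, hΨ, hUΨ⟩ := ih (by omega)
    have hstep := ae_randomTime hτ hN hk hkT (Nat.lt_of_succ_le hn) hS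
    have hr : ∀ i : Finset.range n, (i : ℕ) ∈ Finset.range (n + 1) := fun i =>
      Finset.mem_range.2 ((Finset.mem_range.1 i.2).trans n.lt_succ_self)
    have hrep : ∃ Ψ : (Finset.range (n + 1) → ℝ) → W, Measurable Ψ ∧
        U (n + 1) =ᵐ[P] fun ω => Ψ fun i => τ i ω := by
      -- Uniqueness of the step forces the given iterate to be this composition almost surely.
      refine ⟨fun x => S (n * k + k * x ⟨n, Finset.self_mem_range_succ n⟩,
        Ψ fun i => x ⟨i, hr i⟩), ?_, ?_⟩
      · refine hSm.comp (Measurable.prodMk (by fun_prop) (hΨ.comp ?_))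
        exact measurable_pi_lambda _ fun i => measurable_pi_apply _
      · filter_upwards [hstep, hU.step, hUΨ] with ω h1 h2 h3
        rw [((h1 _ _).1).1 (h2 n (Nat.lt_of_succ_le hn)), h3]
        rfl
    refine ⟨?_, hrep⟩
    obtain ⟨Ψ', hΨ', hUΨ'⟩ := hrep
    have hm : AEStronglyMeasurable (U (n + 1)) P :=
      (AEStronglyMeasurable.congr (hΨ'.comp (measurable_pi_lambda _
        fun i => hτ.measurable i)).stronglyMeasurable.aestronglyMeasurable hUΨ'.symm)
    have hfξ := memLp_comp_randomTime hτ hN hk hkT (Nat.lt_of_succ_le hn) hf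
    refine (((hfξ.norm.add hp.norm).add (memLp_const (1 : ℝ))).const_mul K).mono hm ?_
    filter_upwards [hstep, hU.step] with ω h1 h2
    have h3 := h1 (U n ω) (U (n + 1) ω)
    rw [h3.1.1 (h2 n (Nat.lt_of_succ_le hn))]
    exact h3.2.trans (Real.le_norm_self _)

end Scheme

/-! ### Best approximation -/

section Approximation

variable {V H : Type*}
  [NormedAddCommGroup V] [InnerProductSpace ℝ V]
  [NormedAddCommGroup H] [InnerProductSpace ℝ H]
  {ι : V →L[ℝ] H} {hι : Function.Injective ι} {W : Submodule ℝ V} [FiniteDimensional ℝ W]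

theorem galerkinProj_coe (w : W) : galerkinProj ι hι W (ι w) = w :=
  galerkin_ext ι hι W _ _ fun z => inner_galerkinProj ι hι W _ z

/-- Pythagoras: v − P_h v is H-orthogonal to V_h. -/
theorem norm_sub_galerkinProj_le_distH (v : V) :
    ‖ι v - ι (galerkinProj ι hι W (ι v) : V)‖ ≤ distH ι W v := by
  refine le_ciInf fun w => ?_
  have h : inner ℝ (ι v - ι (galerkinProj ι hι W (ι v) : V))
      (ι ((galerkinProj ι hι W (ι v) - w : W) : V)) = (0 : ℝ) := by
    rw [inner_sub_left, inner_galerkinProj, sub_self]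
  have e : ι v - ι (w : V) = (ι v - ι (galerkinProj ι hι W (ι v) : V))
      + ι ((galerkinProj ι hι W (ι v) - w : W) : V) := by
    rw [Submodule.coe_sub, map_sub]; abel
  have h2 := norm_add_sq_eq_norm_sq_add_norm_sq_real h
  rw [← e] at h2
  exact abs_le_of_sq_le_sq' (by
    nlinarith [norm_nonneg (ι ((galerkinProj ι hι W (ι v) - w : W) : V))]) (norm_nonneg _) |>.2

/-- P_h fixes V_h, so (I − P_h)v = (I − P_h)(v − w) for every w in V_h. Orthogonality in H says
nothing about V, hence the stability factor. -/
theorem norm_sub_galerkinProj_le_distV (v : V) :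
    ‖v - (galerkinProj ι hι W (ι v) : V)‖ ≤ (1 + galerkinProjNormV ι hι W) * distV W v := by
  have hp : 0 ≤ galerkinProjNormV ι hι W := norm_nonneg _
  rw [distV, Real.mul_iInf_of_nonneg (by positivity)]
  refine le_ciInf fun w => ?_
  have e : v - (galerkinProj ι hι W (ι v) : V)
      = (v - w) - (galerkinProj ι hι W (ι (v - w)) : V) := by
    rw [map_sub ι, map_sub (galerkinProj ι hι W), galerkinProj_coe, Submodule.coe_sub]; abel
  rw [e, add_mul, one_mul]
  exact (norm_sub_le _ _).trans (add_le_add le_rfl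
    ((W.subtypeL.comp ((galerkinProj ι hι W).comp ι) : V →L[ℝ] V).le_opNorm _))

end Approximation

/-! ### The energy estimate -/

section Energy

variable {V H : Type*}
  [NormedAddCommGroup V] [InnerProductSpace ℝ V]
  [NormedAddCommGroup H] [InnerProductSpace ℝ H]
  {ι : V →L[ℝ] H} {hι : Function.Injective ι} {W : Submodule ℝ V} [FiniteDimensional ℝ W]
  {T M L μ k : ℝ} {A : ℝ → V → StrongDual ℝ V} {f : ℝ → H}

/-- The energy inequality for one step of the scheme. Here `x` and `b` are consecutive iterates,
`v` and `v'` the exact values that they approximate, and `A(t) y = a`. -/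
theorem energy_step (hk : 0 < k) (hμ : 0 < μ) (hA : IsMonotoneFamily T M L μ A) {t : ℝ}
    (ht : t ∈ Set.Icc 0 T) {x b : W} {g : H}
    (hx : x + k • discreteOp ι hι W A t x = k • galerkinProj ι hι W g + b) (v v' y : V) {a : H}
    (ha : toDualV ι a = A t y) {r : ℝ} (hr : ‖y - (galerkinProj ι hι W (ι v) : V)‖ ≤ r)
    (hL : 0 < L) :
    ‖ι ((x - galerkinProj ι hι W (ι v) : W) : V)‖ ^ 2
      + k * μ * ‖x - galerkinProj ι hι W (ι v)‖ ^ 2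
      ≤ ‖ι ((b - galerkinProj ι hι W (ι v') : W) : V)‖ ^ 2
        + ‖k • (g - a) - (ι v - ι v')‖ ^ 2
        + 2 * inner ℝ (ι ((b - galerkinProj ι hι W (ι v') : W) : V))
          (k • (g - a) - (ι v - ι v'))
        + k * (L ^ 2 / μ * r ^ 2) := by
  set p := galerkinProj ι hι W (ι v) with hp
  set p' := galerkinProj ι hι W (ι v') with hp'
  set θ := x - p with hθ
  set θ' := b - p' with hθ'
  set D := k • (g - a) - (ι v - ι v') with hD
  have h1 : (inner ℝ (ι x) (ι θ) : ℝ) + k * A t x θ = k * inner ℝ g (ι θ) + inner ℝ (ι b) (ι θ) := by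
    have := congrArg (fun w : W => (inner ℝ (ι (w : V)) (ι (θ : V)) : ℝ)) hx
    simpa [inner_add_left, inner_smul_left, inner_discreteOp, inner_galerkinProj] using this
  have h2 : (inner ℝ (ι p) (ι θ) : ℝ) = inner ℝ (ι v) (ι θ) := inner_galerkinProj ι hι W _ _
  have h3 : (inner ℝ (ι p') (ι θ) : ℝ) = inner ℝ (ι v') (ι θ) := inner_galerkinProj ι hι W _ _
  have h4 : (inner ℝ a (ι θ) : ℝ) = A t y θ := by rw [← ha]; rfl
  have h5 : μ * ‖θ‖ ^ 2 ≤ (A t x - A t p) θ := hA.strongly_monotone t ht x p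
  have h6 : (A t y - A t p) θ ≤ L * r * ‖θ‖ := by
    refine (Real.le_norm_self _).trans (((A t y - A t p).le_opNorm _).trans ?_)
    rw [Submodule.norm_coe]
    gcongr
    exact (hA.lipschitz t ht y p).trans (by gcongr)
  have e1 : (ι (θ : V) : H) = ι (x : V) - ι (p : V) := by rw [hθ, Submodule.coe_sub, map_sub]
  have e2 : (ι (θ' : V) : H) = ι (b : V) - ι (p' : V) := by rw [hθ', Submodule.coe_sub, map_sub]
  -- The error identity: both projections disappear because θ lies in the Galerkin space.
  have h7 : (inner ℝ (ι θ - ι θ') (ι θ) : ℝ) + k * ((A t x - A t p) θ)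
      = inner ℝ D (ι θ) + k * ((A t y - A t p) θ) := by
    have e3 : (inner ℝ (ι θ - ι θ') (ι θ) : ℝ) = inner ℝ (ι x) (ι θ) - inner ℝ (ι p) (ι θ)
        - (inner ℝ (ι b) (ι θ) - inner ℝ (ι p') (ι θ)) := by
      conv_lhs => rw [inner_sub_left]
      nth_rw 1 [e1]
      rw [e2, inner_sub_left, inner_sub_left]
    have e4 : (inner ℝ D (ι θ) : ℝ) = k * (inner ℝ g (ι θ) - inner ℝ a (ι θ))
        - (inner ℝ (ι v) (ι θ) - inner ℝ (ι v') (ι θ)) := by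
      rw [hD, inner_sub_left, real_inner_smul_left, inner_sub_left, inner_sub_left]
    rw [e3, e4]
    simp only [_root_.sub_apply]
    rw [h4]
    linarith
  -- θ depends on the current random time and θ' does not, so only (θ', D) may stay; the increment
  -- is paid for by the dissipation in `h9`.
  have h8 : 2 * (inner ℝ D (ι θ) : ℝ)
      ≤ ‖D‖ ^ 2 + ‖ι θ - ι θ'‖ ^ 2 + 2 * inner ℝ (ι θ') D := by
    have e5 := norm_sub_sq_real D (ι θ - ι θ')
    rw [inner_sub_right, real_inner_comm (ι (θ' : V)) D] at e5
    nlinarith [sq_nonneg ‖D - (ι θ - ι θ')‖]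
  have h9 : 2 * (inner ℝ (ι θ - ι θ') (ι θ) : ℝ)
      = ‖ι θ‖ ^ 2 - ‖ι θ'‖ ^ 2 + ‖ι θ - ι θ'‖ ^ 2 := by
    rw [norm_sub_sq_real, inner_sub_left, real_inner_self_eq_norm_sq,
      real_inner_comm (ι (θ : V)) (ι (θ' : V))]
    ring
  -- Young's inequality, weighted to use up exactly half of the 2μ‖θ‖² given by coercivity.
  have h10 : 2 * (L * r * ‖θ‖) ≤ μ * ‖θ‖ ^ 2 + L ^ 2 / μ * r ^ 2 := by
    have : 0 ≤ (μ * ‖θ‖ - L * r) ^ 2 / μ := by positivity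
    have e : (μ * ‖θ‖ - L * r) ^ 2 / μ
        = μ * ‖θ‖ ^ 2 + L ^ 2 / μ * r ^ 2 - 2 * (L * r * ‖θ‖) := by
      field_simp; ring
    linarith
  have h5' := mul_le_mul_of_nonneg_left h5 hk.le
  have h6' := mul_le_mul_of_nonneg_left h6 hk.le
  have h10' := mul_le_mul_of_nonneg_left h10 hk.le
  nlinarith

theorem integrable_inner_of_memLp_two {Ω : Type*} [MeasurableSpace Ω] {P : Measure Ω}
    {g₁ g₂ : Ω → H} (h₁ : MemLp g₁ 2 P) (h₂ : MemLp g₂ 2 P) :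
    Integrable (fun ω => (inner ℝ (g₁ ω) (g₂ ω) : ℝ)) P := by
  refine Integrable.mono' ((h₁.integrable_norm_pow (by norm_num)).add
    (h₂.integrable_norm_pow (by norm_num))) (h₁.1.inner h₂.1) (ae_of_all _ fun ω => ?_)
  refine (norm_inner_le_norm _ _).trans ?_
  have h : ‖g₁ ω‖ * ‖g₂ ω‖ ≤ ‖g₁ ω‖ ^ 2 + ‖g₂ ω‖ ^ 2 := by
    nlinarith [sq_nonneg (‖g₁ ω‖ - ‖g₂ ω‖), sq_nonneg (‖g₁ ω‖), sq_nonneg (‖g₂ ω‖)]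
  exact h

variable {Ω : Type*} [MeasurableSpace Ω] {P : Measure Ω} [IsProbabilityMeasure P]
  {τ : ℕ → Ω → ℝ} {N : ℕ}

/-- The fluctuation of a randomized quadrature step has mean zero and bounded variance. -/
theorem integral_quadrature_error [CompleteSpace H] (hτ : IsUniformSequence P τ) (hN : 0 < N)
    (hk : 0 < k) (hkT : k = T / N) {n : ℕ} (hn : n < N) {g : ℝ → H}
    (hg : MemLp g 2 (timeMeasure T)) {m : H} (hm : m = ∫ t in n * k..(n + 1 : ℕ) * k, g t) :
    ∫ ω, (k • g (randomTime k τ n ω) - m) ∂P = 0 ∧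
    ∫ ω, ‖k • g (randomTime k τ n ω) - m‖ ^ 2 ∂P
      ≤ k * ∫ t in n * k..(n + 1 : ℕ) * k, ‖g t‖ ^ 2 := by
  have hgξ := memLp_comp_randomTime hτ hN hk hkT hn hg
  have hi : Integrable (fun ω => k • g (randomTime k τ n ω)) P :=
    (hgξ.integrable (by norm_num)).smul k
  have hmean : ∫ ω, k • g (randomTime k τ n ω) ∂P = m := by
    rw [integral_smul, integral_comp_randomTime hτ hN hk hkT hn hg.1, hm]
  refine ⟨by rw [integral_sub hi (integrable_const _), hmean]; simp, ?_⟩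
  have hsq : Integrable (fun ω => ‖k • g (randomTime k τ n ω)‖ ^ 2) P :=
    (hgξ.const_smul k).integrable_norm_pow (by norm_num)
  -- The variance is the second moment minus ‖m‖², which is dropped. Of the k² in the second moment,
  -- one factor turns the expectation into a time integral and the other produces the rate k^{1/2}.
  have e : ∀ ω, ‖k • g (randomTime k τ n ω) - m‖ ^ 2
      = ‖k • g (randomTime k τ n ω)‖ ^ 2 - 2 * inner ℝ m (k • g (randomTime k τ n ω))
        + ‖m‖ ^ 2 := fun ω => by rw [norm_sub_sq_real, real_inner_comm]
  simp only [e]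
  have hsub : Integrable (fun ω => ‖k • g (randomTime k τ n ω)‖ ^ 2
      - 2 * inner ℝ m (k • g (randomTime k τ n ω))) P :=
    hsq.sub ((hi.const_inner m).const_mul 2)
  rw [integral_add hsub (integrable_const _),
    integral_sub hsq ((hi.const_inner m).const_mul 2), integral_const_mul, integral_inner hi,
    hmean, real_inner_self_eq_norm_sq]
  have e2 : ∫ ω, ‖k • g (randomTime k τ n ω)‖ ^ 2 ∂P
      = k * ∫ t in n * k..(n + 1 : ℕ) * k, ‖g t‖ ^ 2 := by
    rw [← integral_comp_randomTime hτ hN hk hkT hn (g := fun t => ‖g t‖ ^ 2) (hg.1.norm.pow 2),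
      smul_eq_mul, ← integral_const_mul, ← integral_const_mul]
    congr 1; funext ω
    rw [norm_smul, Real.norm_of_nonneg hk.le]
    ring
  rw [e2]
  simp only [integral_const, probReal_univ, smul_eq_mul, one_mul]
  nlinarith [sq_nonneg ‖m‖]

/-- An iterate of the scheme is independent of the next random time. -/
theorem IsSchemeSolution.indepFun_randomTime [MeasurableSpace W]
    [BorelSpace W] (hτ : IsUniformSequence P τ) (hμ : 0 < μ) (hL : 0 < L)
    (hN : 0 < N) (hk : 0 < k) (hkT : k = T / N) (hA : IsMonotoneFamily T M L μ A)
    (hf : MemLp f 2 (timeMeasure T)) {u₀ : H} {U : ℕ → Ω → W}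
    (hU : IsSchemeSolution P τ ι hι W A f u₀ k N U) {n : ℕ} (hn : n ≤ N) :
    ProbabilityTheory.IndepFun (U n) (randomTime k τ n) P := by
  obtain ⟨-, Ψ, hΨ, hUΨ⟩ := hU.memLp_and_eq_comp hτ hμ hL hN hk hkT hA hf hn
  -- The n-th iterate uses the indices below n, and the next random time uses the index n alone.
  have h := hτ.indep.indepFun_finset (Finset.range n) {n}
    (by simp [Finset.disjoint_singleton_right]) hτ.measurable
  have h2 := h.comp hΨ (ψ := fun x : ({n} : Finset ℕ) → ℝ =>
    n * k + k * x ⟨n, Finset.mem_singleton_self n⟩) (by fun_prop)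
  exact h2.congr hUΨ.symm (EventuallyEq.refl _ _)

/-- The energy inequality in expectation. -/
theorem integral_energy_step [CompleteSpace H] (hτ : IsUniformSequence P τ) (hμ : 0 < μ)
    (hL : 0 < L) (hN : 0 < N) (hk : 0 < k) (hkT : k = T / N) (hA : IsMonotoneFamily T M L μ A)
    (hf : MemLp f 2 (timeMeasure T)) {u₀ : H} {U : ℕ → Ω → W}
    (hU : IsSchemeSolution P τ ι hι W A f u₀ k N U) {n : ℕ} (hn : n < N) {u : ℝ → V} {Au : ℝ → H}
    (hAu : MemLp Au 2 (timeMeasure T)) (hAuA : ∀ᵐ t ∂timeMeasure T, toDualV ι (Au t) = A t (u t))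
    (hm : ι (u ((n + 1 : ℕ) * k)) - ι (u (n * k))
      = ∫ t in n * k..(n + 1 : ℕ) * k, (f t - Au t)) {r : ℝ}
    (hr : ∀ t ∈ Set.Ioo (n * k) ((n + 1 : ℕ) * k),
      ‖u t - (galerkinProj ι hι W (ι (u ((n + 1 : ℕ) * k))) : V)‖ ≤ r) :
    ∫ ω, ‖ι ((U (n + 1) ω - galerkinProj ι hι W (ι (u ((n + 1 : ℕ) * k))) : W) : V)‖ ^ 2 ∂P
      + k * μ * ∫ ω, ‖U (n + 1) ω - galerkinProj ι hι W (ι (u ((n + 1 : ℕ) * k)))‖ ^ 2 ∂P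
      ≤ ∫ ω, ‖ι ((U n ω - galerkinProj ι hι W (ι (u (n * k))) : W) : V)‖ ^ 2 ∂P
        + k * (∫ t in n * k..(n + 1 : ℕ) * k, ‖f t - Au t‖ ^ 2)
        + k * (L ^ 2 / μ * r ^ 2) := by
  let _ : MeasurableSpace W := borel W
  have : BorelSpace W := ⟨rfl⟩
  have hg : MemLp (fun t => f t - Au t) 2 (timeMeasure T) := hf.sub hAu
  set m := ι (u ((n + 1 : ℕ) * k)) - ι (u (n * k))
  obtain ⟨hD0, hD2⟩ := integral_quadrature_error hτ hN hk hkT hn hg hm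
  have hgξ := memLp_comp_randomTime hτ hN hk hkT hn hg
  have hDp : MemLp (fun ω => k • (f (randomTime k τ n ω) - Au (randomTime k τ n ω)) - m) 2 P :=
    (hgξ.const_smul k).sub (memLp_const m)
  have hθ : ∀ j ≤ N, MemLp (fun ω => U j ω - galerkinProj ι hι W (ι (u (j * k)))) 2 P :=
    fun j hj => (hU.memLp_and_eq_comp hτ hμ hL hN hk hkT hA hf hj).1.sub (memLp_const _)
  have hιθ : ∀ j ≤ N, MemLp (fun ω => ι ((U j ω - galerkinProj ι hι W (ι (u (j * k))) : W) : V))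
      2 P := fun j hj => (ι.comp W.subtypeL).comp_memLp' (hθ j hj)
  have hind := hU.indepFun_randomTime hτ hμ hL hN hk hkT hA hf hn.le
  -- By independence the expectation of the inner product is the inner product of the expectations,
  -- and that of the quadrature error is zero.
  have hcross : ∫ ω, inner ℝ (ι ((U n ω - galerkinProj ι hι W (ι (u (n * k))) : W) : V))
      (k • (f (randomTime k τ n ω) - Au (randomTime k τ n ω)) - m) ∂P = (0 : ℝ) := by
    have hUm : AEMeasurable (U n) P :=
      (hU.memLp_and_eq_comp hτ hμ hL hN hk hkT hA hf hn.le).1.1.aemeasurable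
    have hξm : AEMeasurable (randomTime k τ n) P := (measurable_randomTime hτ k n).aemeasurable
    have hc : Continuous fun w : W =>
        ι ((w - galerkinProj ι hι W (ι (u (n * k))) : W) : V) := by fun_prop
    have h1 : Integrable (fun w : W => ι ((w - galerkinProj ι hι W (ι (u (n * k))) : W) : V))
        (P.map (U n)) :=
      (integrable_map_measure hc.stronglyMeasurable.aestronglyMeasurable hUm).2
        ((hιθ n hn.le).integrable (by norm_num))
    have h2 : Integrable (fun t => k • (f t - Au t) - m) (P.map (randomTime k τ n)) := by
      have : IsProbabilityMeasure (P.map (randomTime k τ n)) :=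
        Measure.isProbabilityMeasure_map hξm
      exact (((memLp_map_randomTime hτ hN hk hkT hn hg).integrable (by norm_num)).smul k).sub
        (integrable_const m)
    have h3 := hind.integral_bilin_comp_comp hUm hξm h1 h2
      (isBoundedBilinearMap_inner (𝕜 := ℝ) (E := H)).toContinuousLinearMap
    have h4 : ∀ x y : H, (isBoundedBilinearMap_inner (𝕜 := ℝ) (E := H)).toContinuousLinearMap x y
        = (inner ℝ x y : ℝ) := fun x y => rfl
    simp only [h4] at h3
    rw [h3, hD0, inner_zero_right]
  have hsq : ∀ {X : Type _} [NormedAddCommGroup X] {g : Ω → X}, MemLp g 2 P →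
      Integrable (fun ω => ‖g ω‖ ^ 2) P := fun hg => hg.integrable_norm_pow (by norm_num)
  have hsqV : Integrable
      (fun ω => ‖U (n + 1) ω - galerkinProj ι hι W (ι (u ((n + 1 : ℕ) * k)))‖ ^ 2) P :=
    (hθ (n + 1) hn).integrable_norm_pow (by norm_num)
  have hi1 := hsq (hιθ (n + 1) hn)
  have hi0 := hsq (hιθ n hn.le)
  have hiD := hsq hDp
  have hicross : Integrable (fun ω => (inner ℝ
      (ι ((U n ω - galerkinProj ι hι W (ι (u (n * k))) : W) : V))
      (k • (f (randomTime k τ n ω) - Au (randomTime k τ n ω)) - m) : ℝ)) P :=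
    integrable_inner_of_memLp_two (hιθ n hn.le) hDp
  have hle := integral_mono_ae (hi1.add (hsqV.const_mul (k * μ)))
    (((hi0.add hiD).add (hicross.const_mul 2)).add (integrable_const (k * (L ^ 2 / μ * r ^ 2))))
    (by
      have hTk : T = N * k := by rw [hkT]; field_simp
      filter_upwards [hU.step, ae_randomTime hτ hN hk hkT hn hAuA, ae_randomTime_mem hτ hk n]
        with ω h1 h2 h3
      have hmem : randomTime k τ n ω ∈ Set.Icc 0 T := by
        refine ⟨le_trans (by positivity) h3.1.le, h3.2.le.trans ?_⟩
        rw [hTk]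
        gcongr
        exact_mod_cast hn
      exact energy_step hk hμ hA hmem (h1 n hn) (u ((n + 1 : ℕ) * k)) (u (n * k)) _ h2 (hr _ h3) hL)
  rw [integral_add' hi1 (hsqV.const_mul _), integral_const_mul,
    integral_add' ((hi0.add hiD).add (hicross.const_mul 2)) (integrable_const _),
    integral_add' (hi0.add hiD) (hicross.const_mul 2), integral_add' hi0 hiD, integral_const_mul,
    hcross, mul_zero, add_zero] at hle
  simp only [integral_const, probReal_univ, smul_eq_mul, one_mul] at hle
  exact hle.trans (add_le_add (add_le_add le_rfl hD2) le_rfl)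

end Energy

/-! ### The error estimate -/

theorem sum_Icc_one_eq_sum_range (F : ℕ → ℝ) (N : ℕ) :
    ∑ n ∈ Finset.Icc 1 N, F n = ∑ n ∈ Finset.range N, F (n + 1) := by
  induction N with
  | zero => simp
  | succ N ih => rw [Finset.sum_Icc_succ_top (by omega), ih, Finset.sum_range_succ]

theorem l2norm_sub_le {α X : Type*} [MeasurableSpace α] [NormedAddCommGroup X] {ν : Measure α}
    {g₁ g₂ : α → X} (h₁ : MemLp g₁ 2 ν) (h₂ : MemLp g₂ 2 ν) :
    l2norm ν (fun a => g₁ a - g₂ a) ≤ l2norm ν g₁ + l2norm ν g₂ := by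
  rw [l2norm, l2norm, l2norm, ← ENNReal.toReal_add h₁.2.ne h₂.2.ne]
  exact ENNReal.toReal_mono (ENNReal.add_ne_top.2 ⟨h₁.2.ne, h₂.2.ne⟩)
    (eLpNorm_sub_le h₁.1 h₂.1 (by norm_num))

theorem l2norm_const {α X : Type*} [MeasurableSpace α] [NormedAddCommGroup X] (ν : Measure α)
    [IsProbabilityMeasure ν] (x : X) : l2norm ν (fun _ => x) = ‖x‖ := by
  rw [l2norm, eLpNorm_const x (by norm_num) (IsProbabilityMeasure.ne_zero ν)]
  simp

section Estimate

variable {V H : Type*}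
  [NormedAddCommGroup V] [InnerProductSpace ℝ V]
  [NormedAddCommGroup H] [InnerProductSpace ℝ H] [CompleteSpace H]
  {ι : V →L[ℝ] H} {hι : Function.Injective ι} {W : Submodule ℝ V} [FiniteDimensional ℝ W]
  {T M L μ k : ℝ} {A : ℝ → V → StrongDual ℝ V} {f : ℝ → H}
  {Ω : Type*} [MeasurableSpace Ω] {P : Measure Ω} [IsProbabilityMeasure P]
  {τ : ℕ → Ω → ℝ} {N : ℕ}

/-- The energy estimate for the discrete part `U^n - P_h u(t_n)` of the error. -/
theorem energy_estimate (hT : 0 < T) (hτ : IsUniformSequence P τ) (hμ : 0 < μ)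
    (hL : 0 < L) (hN : 0 < N) (hk : 0 < k) (hkT : k = T / N) (hd : DenseRange ι)
    (hA : IsMonotoneFamily T M L μ A)
    (hf : MemLp f 2 (timeMeasure T)) {u₀ : V} {U : ℕ → Ω → W}
    (hU : IsSchemeSolution P τ ι hι W A f (ι u₀) k N U) {u : ℝ → V}
    (hu : IsWeakSolution ι T A f (ι u₀) u) {γ : NNReal} (hγ : 0 < γ)
    (huγ : MemHolderSpace T γ u) {Au : ℝ → H}
    (hAu : MemLp Au 2 (timeMeasure T)) (hAuA : ∀ᵐ t ∂timeMeasure T, toDualV ι (Au t) = A t (u t))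
    {n : ℕ} (hn : n ≤ N) :
    l2norm P (fun ω => ι ((U n ω - galerkinProj ι hι W (ι (u (n * k))) : W) : V)) ^ 2
      + k * μ * ∑ j ∈ Finset.range n,
        l2norm P (fun ω => U (j + 1) ω - galerkinProj ι hι W (ι (u ((j + 1 : ℕ) * k)))) ^ 2
      ≤ ∑ j ∈ Finset.range n, (k * (∫ t in j * k..(j + 1 : ℕ) * k, ‖f t - Au t‖ ^ 2)
        + k * (L ^ 2 / μ * (k ^ (γ : ℝ) * holderSpaceNorm T γ u
          + (1 + galerkinProjNormV ι hι W) * distV W (u ((j + 1 : ℕ) * k))) ^ 2)) := by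
  let _ : MeasurableSpace W := borel W
  have : BorelSpace W := ⟨rfl⟩
  have huc := huγ.continuousOn hγ
  have hTk : T = N * k := by rw [hkT]; field_simp
  have hmem : ∀ j ≤ N, (j * k : ℝ) ∈ Set.Icc 0 T := fun j hj => by
    refine ⟨by positivity, ?_⟩
    rw [hTk]; gcongr
  have hθ : ∀ j ≤ N, MemLp (fun ω => U j ω - galerkinProj ι hι W (ι (u (j * k)))) 2 P :=
    fun j hj => (hU.memLp_and_eq_comp hτ hμ hL hN hk hkT hA hf hj).1.sub (memLp_const _)
  have hιθ : ∀ j ≤ N, MemLp (fun ω => ι ((U j ω - galerkinProj ι hι W (ι (u (j * k))) : W) : V))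
      2 P := fun j hj => (ι.comp W.subtypeL).comp_memLp' (hθ j hj)
  induction n with
  | zero =>
    -- The scheme starts at P_h u₀ and u(0) = u₀, so the discrete error starts at zero.
    have h0 : (fun ω => ι ((U 0 ω - galerkinProj ι hι W (ι (u ((0 : ℕ) * k))) : W) : V))
        =ᵐ[P] fun _ => 0 := by
      filter_upwards [hU.initial] with ω hω
      rw [hω, Nat.cast_zero, zero_mul, hu.apply_zero hT hι huc, sub_self]
      simp
    have h1 : l2norm P (fun ω => ι ((U 0 ω - galerkinProj ι hι W (ι (u ((0 : ℕ) * k))) : W) : V))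
        = 0 := by
      rw [l2norm, eLpNorm_congr_ae h0]; simp
    rw [h1]
    simp
  | succ n ih =>
    have hn' : n < N := hn
    have hstep := integral_energy_step hτ hμ hL hN hk hkT hA hf hU hn' (u := u) hAu hAuA
      (hu.sub_eq_integral hT hd huc hf hAu hAuA (hmem n hn'.le) (hmem (n + 1) hn))
      (r := k ^ (γ : ℝ) * holderSpaceNorm T γ u
          + (1 + galerkinProjNormV ι hι W) * distV W (u ((n + 1 : ℕ) * k))) (fun t ht => by
        have ht' : t ∈ Set.Icc 0 T :=
          ⟨(hmem n hn'.le).1.trans ht.1.le, ht.2.le.trans (hmem (n + 1) hn).2⟩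
        -- The random time is within k of t_{n+1}: Hölder continuity bounds the first difference,
        -- best approximation the second.
        have e : u t - (galerkinProj ι hι W (ι (u ((n + 1 : ℕ) * k))) : V)
            = (u t - u ((n + 1 : ℕ) * k)) + (u ((n + 1 : ℕ) * k)
              - (galerkinProj ι hι W (ι (u ((n + 1 : ℕ) * k))) : V)) := by abel
        rw [e]
        refine (norm_add_le _ _).trans (add_le_add ?_ (norm_sub_galerkinProj_le_distV _))
        refine (huγ.norm_sub_le ht' (hmem (n + 1) hn)).trans ?_
        rw [mul_comm]
        have hnn := holderSpaceNorm_nonneg T γ u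
        gcongr
        have h1 := ht.1
        have h2 := ht.2
        push_cast at h2 ⊢
        rw [abs_le]
        constructor <;> linarith)
    have hih := ih hn'.le
    rw [Finset.sum_range_succ, Finset.sum_range_succ, l2norm_sq (hιθ (n + 1) hn),
      l2norm_sq (hθ (n + 1) hn)]
    rw [l2norm_sq (hιθ n hn'.le)] at hih
    linarith

/-- The error estimate in terms of abstract quantities: `a`, `b` are the norms of the discrete
errors, `dH`, `dV` the approximation errors, `eH`, `eV` the norms of the errors. -/
theorem error_bound_of_energy {a b eH eV dV : ℕ → ℝ} {G β p sH : ℝ} (hT : 0 < T) (hμ : 0 < μ)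
    (hk : 0 < k) (hkT : k * N = T) (hβ : 0 ≤ β) (hG : 0 ≤ G) (hp : 0 ≤ p)
    (heV0 : ∀ n, 0 ≤ eV n)
    (hen : ∀ n ≤ N, a n ^ 2 + k * μ * ∑ j ∈ Finset.range n, b (j + 1) ^ 2
      ≤ k * G ^ 2 + ∑ j ∈ Finset.range N, k * (L ^ 2 / μ * (β + (1 + p) * dV (j + 1)) ^ 2))
    (heH : ∀ n ≤ N, eH n ≤ a n + sH)
    (heV : ∀ n ∈ Finset.Icc 1 N, eV n ≤ b n + (1 + p) * dV n) (hsH : 0 ≤ sH) :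
    (⨆ n : Fin (N + 1), eH n) + √(k * ∑ n ∈ Finset.Icc 1 N, eV n ^ 2)
      ≤ (√(1 + 2 * (L ^ 2 / μ) * (T + 1)) + 1
          + √(2 * ((1 + 2 * (L ^ 2 / μ) * (T + 1)) / μ) + 2))
        * (√k * G + β + sH + (1 + p) * √(k * ∑ n ∈ Finset.Icc 1 N, dV n ^ 2)) := by
  -- The total energy is at most K2 (α + β + δ)². The maximum in H then costs √K2, the projection
  -- error in H costs 1, and the V-sum costs √(2 K2/μ + 2), from squaring a sum of two terms.
  set K2 := 1 + 2 * (L ^ 2 / μ) * (T + 1) with hK2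
  have hl : 0 ≤ L ^ 2 / μ := by positivity
  have hK2p : 0 ≤ K2 := by positivity
  set D := ∑ n ∈ Finset.Icc 1 N, dV n ^ 2 with hD
  have hD0 : 0 ≤ D := Finset.sum_nonneg fun _ _ => by positivity
  set δ := (1 + p) * √(k * D) with hδ
  have hδ0 : 0 ≤ δ := by positivity
  have hδ2 : δ ^ 2 = (1 + p) ^ 2 * (k * D) := by
    rw [hδ, mul_pow, Real.sq_sqrt (by positivity)]
  set α := √k * G with hα
  have hα0 : 0 ≤ α := by positivity
  have hα2 : α ^ 2 = k * G ^ 2 := by rw [hα, mul_pow, Real.sq_sqrt hk.le]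
  set S := α + β + δ with hS
  have hS0 : 0 ≤ S := by positivity
  have hsq : ∑ j ∈ Finset.range N, k * (L ^ 2 / μ * (β + (1 + p) * dV (j + 1)) ^ 2)
      ≤ L ^ 2 / μ * (2 * T * β ^ 2 + 2 * δ ^ 2) := by
    calc _ ≤ ∑ j ∈ Finset.range N, (L ^ 2 / μ * (2 * k * β ^ 2)
          + L ^ 2 / μ * (2 * k * (1 + p) ^ 2) * dV (j + 1) ^ 2) := by
          refine Finset.sum_le_sum fun j _ => ?_
          have : (β + (1 + p) * dV (j + 1)) ^ 2 ≤ 2 * β ^ 2 + 2 * ((1 + p) * dV (j + 1)) ^ 2 := by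
            nlinarith [sq_nonneg (β - (1 + p) * dV (j + 1))]
          calc _ ≤ k * (L ^ 2 / μ * (2 * β ^ 2 + 2 * ((1 + p) * dV (j + 1)) ^ 2)) := by gcongr
            _ = _ := by ring
      -- Here N k = T turns the N copies of k β² into T β².
      _ = _ := by
          rw [Finset.sum_add_distrib, Finset.sum_const, Finset.card_range, nsmul_eq_mul,
            ← Finset.mul_sum, ← sum_Icc_one_eq_sum_range (fun n => dV n ^ 2), ← hD, hδ2, ← hkT]
          ring
  have hQ : ∀ n ≤ N, a n ^ 2 + k * μ * ∑ j ∈ Finset.range n, b (j + 1) ^ 2 ≤ K2 * S ^ 2 := by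
    intro n hn
    refine (hen n hn).trans ((add_le_add_right hsq _).trans ?_)
    rw [← hα2]
    have hα' : α ^ 2 ≤ S ^ 2 := pow_le_pow_left₀ hα0 (by linarith) 2
    have hβ' : T * β ^ 2 ≤ T * S ^ 2 :=
      mul_le_mul_of_nonneg_left (pow_le_pow_left₀ hβ (by linarith) 2) hT.le
    have hδ' : δ ^ 2 ≤ S ^ 2 := pow_le_pow_left₀ hδ0 (by linarith) 2
    have h1 : 2 * T * β ^ 2 + 2 * δ ^ 2 ≤ 2 * (T + 1) * S ^ 2 := by linarith
    have h2 := mul_le_mul_of_nonneg_left h1 hl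
    rw [hK2]
    linarith
  have haN : ∀ n ≤ N, a n ≤ √K2 * S := by
    intro n hn
    refine abs_le_of_sq_le_sq' ?_ (by positivity) |>.2
    rw [mul_pow, Real.sq_sqrt hK2p]
    refine le_trans (le_add_of_nonneg_right ?_) (hQ n hn)
    have : 0 ≤ ∑ j ∈ Finset.range n, b (j + 1) ^ 2 := Finset.sum_nonneg fun _ _ => by positivity
    positivity
  have hB : k * ∑ n ∈ Finset.Icc 1 N, b n ^ 2 ≤ K2 / μ * S ^ 2 := by
    rw [sum_Icc_one_eq_sum_range fun n => b n ^ 2, div_mul_eq_mul_div, le_div_iff₀ hμ]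
    linarith [hQ N le_rfl, sq_nonneg (a N)]
  have h1 : (⨆ n : Fin (N + 1), eH n) ≤ √K2 * S + sH :=
    ciSup_le fun n => (heH n (Nat.lt_succ_iff.1 n.2)).trans
      (add_le_add (haN n (Nat.lt_succ_iff.1 n.2)) le_rfl)
  have h2 : √(k * ∑ n ∈ Finset.Icc 1 N, eV n ^ 2) ≤ √(2 * (K2 / μ) + 2) * S := by
    rw [← Real.sqrt_sq hS0, ← Real.sqrt_mul (by positivity)]
    refine Real.sqrt_le_sqrt ?_
    have h3 : ∑ n ∈ Finset.Icc 1 N, eV n ^ 2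
        ≤ 2 * ∑ n ∈ Finset.Icc 1 N, b n ^ 2 + 2 * (1 + p) ^ 2 * D := by
      rw [hD, Finset.mul_sum, Finset.mul_sum, ← Finset.sum_add_distrib]
      refine Finset.sum_le_sum fun n hn => ?_
      have h4 := pow_le_pow_left₀ (heV0 n) (heV n hn) 2
      nlinarith [sq_nonneg (b n - (1 + p) * dV n)]
    have h5 := mul_le_mul_of_nonneg_left h3 hk.le
    have h6 : δ ^ 2 ≤ S ^ 2 := pow_le_pow_left₀ hδ0 (by linarith) 2
    linarith
  have h3 : 0 ≤ √K2 * sH := by positivity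
  have h4 : 0 ≤ √(2 * (K2 / μ) + 2) * sH := by positivity
  have e : α + β + sH + δ = S + sH := by rw [hS]; ring
  rw [e]
  linarith

/-- Convergence of the randomized scheme, with an explicit constant. -/
theorem error_estimate (hT : 0 < T) (hτ : IsUniformSequence P τ) (hμ : 0 < μ)
    (hL : 0 < L) (hN : 0 < N) (hk : 0 < k) (hkT : k = T / N) (hd : DenseRange ι)
    (hA : IsMonotoneFamily T M L μ A)
    (hf : MemLp f 2 (timeMeasure T)) {u₀ : V} {U : ℕ → Ω → W}
    (hU : IsSchemeSolution P τ ι hι W A f (ι u₀) k N U) {u : ℝ → V}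
    (hu : IsWeakSolution ι T A f (ι u₀) u) {γ : NNReal} (hγ : 0 < γ)
    (huγ : MemHolderSpace T γ u) {Au : ℝ → H}
    (hAu : MemLp Au 2 (timeMeasure T))
    (hAuA : ∀ᵐ t ∂timeMeasure T, toDualV ι (Au t) = A t (u t)) :
    (⨆ n : Fin (N + 1), l2norm P (fun ω => ι (U n ω : V) - ι (u (n * k))))
      + √(k * ∑ n ∈ Finset.Icc 1 N, l2norm P (fun ω => (U n ω : V) - u (n * k)) ^ 2)
    ≤ (√(1 + 2 * (L ^ 2 / μ) * (T + 1)) + 1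
          + √(2 * ((1 + 2 * (L ^ 2 / μ) * (T + 1)) / μ) + 2))
      * (√k * (l2norm (timeMeasure T) f + l2norm (timeMeasure T) Au)
        + k ^ (γ : ℝ) * holderSpaceNorm T γ u
        + (⨆ n : Fin (N + 1), distH ι W (u (n * k)))
        + (1 + galerkinProjNormV ι hι W)
          * √(k * ∑ n ∈ Finset.Icc 1 N, distV W (u (n * k)) ^ 2)) := by
  let _ : MeasurableSpace W := borel W
  have : BorelSpace W := ⟨rfl⟩
  have hθ : ∀ j ≤ N, MemLp (fun ω => U j ω - galerkinProj ι hι W (ι (u (j * k)))) 2 P :=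
    fun j hj => (hU.memLp_and_eq_comp hτ hμ hL hN hk hkT hA hf hj).1.sub (memLp_const _)
  have hθV : ∀ j ≤ N,
      MemLp (fun ω => ((U j ω - galerkinProj ι hι W (ι (u (j * k))) : W) : V)) 2 P :=
    fun j hj => W.subtypeL.comp_memLp' (hθ j hj)
  have hιθ : ∀ j ≤ N, MemLp (fun ω => ι ((U j ω - galerkinProj ι hι W (ι (u (j * k))) : W) : V))
      2 P := fun j hj => ι.comp_memLp' (hθV j hj)
  have hbdd : BddAbove (Set.range fun n : Fin (N + 1) => distH ι W (u (n * k))) :=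
    (Set.finite_range _).bddAbove
  have hg := l2norm_sub_le hf hAu
  refine error_bound_of_energy (L := L)
    (a := fun n => l2norm P
      (fun ω => ι ((U n ω - galerkinProj ι hι W (ι (u (n * k))) : W) : V)))
    (b := fun n => l2norm P (fun ω => U n ω - galerkinProj ι hι W (ι (u (n * k)))))
    (eH := fun n => l2norm P (fun ω => ι (U n ω : V) - ι (u (n * k))))
    (eV := fun n => l2norm P (fun ω => (U n ω : V) - u (n * k)))
    (dV := fun n => distV W (u (n * k))) hT hμ hk (by rw [hkT]; field_simp)
    (mul_nonneg (by positivity) (holderSpaceNorm_nonneg T γ u))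
    (add_nonneg (l2norm_nonneg _ _) (l2norm_nonneg _ _)) (norm_nonneg _)
    (fun n => l2norm_nonneg _ _)
    (fun n hn => ?_) (fun n hn => ?_) (fun n hn => ?_)
    (Real.iSup_nonneg fun n => Real.iInf_nonneg fun _ => norm_nonneg _)
  · refine (energy_estimate hT hτ hμ hL hN hk hkT hd hA hf hU hu hγ huγ hAu hAuA hn).trans ?_
    -- Extending the sum to all N steps makes the bound uniform in n, and the step integrals add up
    -- to the full L² norm.
    have hmono : Finset.range n ⊆ Finset.range N := Finset.range_mono hn
    refine (Finset.sum_le_sum_of_subset_of_nonneg hmono fun j _ _ => ?_).trans ?_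
    · have : 0 ≤ ∫ t in j * k..(j + 1 : ℕ) * k, ‖f t - Au t‖ ^ 2 :=
        intervalIntegral.integral_nonneg (by gcongr; simp) fun _ _ => by positivity
      positivity
    · rw [Finset.sum_add_distrib, ← Finset.mul_sum,
        integral_norm_sq_timeMeasure_eq_sum hN hk hkT (g := fun t => f t - Au t) (hf.sub hAu)]
      have := l2norm_nonneg (timeMeasure T) (fun t => f t - Au t)
      gcongr
  · have e : (fun ω => ι (U n ω : V) - ι (u (n * k)))
        = fun ω => ι ((U n ω - galerkinProj ι hι W (ι (u (n * k))) : W) : V)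
          - (ι (u (n * k)) - ι (galerkinProj ι hι W (ι (u (n * k))) : V)) := by
      funext ω
      rw [Submodule.coe_sub, map_sub]; abel
    simp only [e]
    refine (l2norm_sub_le (hιθ n hn) (memLp_const _)).trans (add_le_add le_rfl ?_)
    rw [l2norm_const]
    exact (norm_sub_galerkinProj_le_distH _).trans (le_ciSup hbdd ⟨n, Nat.lt_succ_of_le hn⟩)
  · have e : (fun ω => (U n ω : V) - u (n * k))
        = fun ω => ((U n ω - galerkinProj ι hι W (ι (u (n * k))) : W) : V)
          - (u (n * k) - (galerkinProj ι hι W (ι (u (n * k))) : V)) := by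
      funext ω
      rw [Submodule.coe_sub]; abel
    simp only [e]
    refine (l2norm_sub_le (hθV n (Finset.mem_Icc.1 hn).2) (memLp_const _)).trans
      (add_le_add le_rfl ?_)
    rw [l2norm_const]
    exact norm_sub_galerkinProj_le_distV _

end Estimate

end GalerkinEuler

theorem mainTheorem2 (T L μ : ℝ) (hT : 0 < T) (hL : 0 < L) (hμ : 0 < μ) :
    ∃ C : ℝ, 0 < C ∧
      ∀ (V : Type*) [NormedAddCommGroup V] [InnerProductSpace ℝ V] [CompleteSpace V]
        [TopologicalSpace.SeparableSpace V]
        (H : Type*) [NormedAddCommGroup H] [InnerProductSpace ℝ H] [CompleteSpace H]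
        [TopologicalSpace.SeparableSpace H]
        (Ω : Type*) [MeasurableSpace Ω] (P : Measure Ω) [IsProbabilityMeasure P]
        -- the Gelfand triple and the evolution equation
        (ι : V →L[ℝ] H) (hι : Function.Injective ι) (_ : DenseRange ι)
        (M : ℝ) (A : ℝ → V → StrongDual ℝ V) (_ : IsMonotoneFamily T M L μ A)
        (f : ℝ → H) (_ : MemLp f 2 (timeMeasure T)) (u₀ : V)
        (u : ℝ → V) (_ : IsWeakSolution ι T A f (ι u₀) u)
        -- the regularity of the solution
        (γ : NNReal) (_ : 0 < γ) (_ : γ < 1) (_ : MemHolderSpace T γ u)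
        (Au : ℝ → H) (_ : MemLp Au 2 (timeMeasure T))
        (_ : ∀ᵐ t ∂timeMeasure T, toDualV ι (Au t) = A t (u t))
        -- the randomization and the Galerkin spaces
        (τ : ℕ → Ω → ℝ) (_ : IsUniformSequence P τ)
        (Vh : Set.Ioo (0 : ℝ) 1 → Submodule ℝ V) [∀ h, FiniteDimensional ℝ (Vh h)]
        (N : ℕ) (_ : 0 < N) (h : Set.Ioo (0 : ℝ) 1) (k : ℝ) (_ : k = T / N),
        (∃ U : ℕ → Ω → Vh h, IsSchemeSolution P τ ι hι (Vh h) A f (ι u₀) k N U) ∧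
        ∀ U : ℕ → Ω → Vh h, IsSchemeSolution P τ ι hι (Vh h) A f (ι u₀) k N U →
          (∀ n ≤ N, MemLp (U n) 2 P) ∧
          (⨆ n : Fin (N + 1), l2norm P (fun ω => ι (U n ω : V) - ι (u (n * k))))
            + √(k * ∑ n ∈ Finset.Icc 1 N, l2norm P (fun ω => (U n ω : V) - u (n * k)) ^ 2)
          ≤ C * (√k * (l2norm (timeMeasure T) f + l2norm (timeMeasure T) Au)
            + k ^ (γ : ℝ) * holderSpaceNorm T γ u
            + (⨆ n : Fin (N + 1), distH ι (Vh h) (u (n * k)))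
            + (1 + galerkinProjNormV ι hι (Vh h))
              * √(k * ∑ n ∈ Finset.Icc 1 N, distV (Vh h) (u (n * k)) ^ 2)) := by
  -- The constant of `error_bound_of_energy`, fixed before the spaces, the operator and the
  -- discretization.
  refine ⟨√(1 + 2 * (L ^ 2 / μ) * (T + 1)) + 1
    + √(2 * ((1 + 2 * (L ^ 2 / μ) * (T + 1)) / μ) + 2), by positivity, ?_⟩
  intro V _ _ _ _ H _ _ _ _ Ω _ P _ ι hι hd M A hA f hf u₀ u hu γ hγ _ huγ Au hAu hAuA τ hτ Vh _
    N hN h k hkT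
  have hk : 0 < k := by rw [hkT]; positivity
  refine ⟨exists_isSchemeSolution hτ hμ hL hN hk hkT hA hf _, fun U hU => ⟨fun n hn => ?_, ?_⟩⟩
  · let _ : MeasurableSpace (Vh h) := borel (Vh h)
    have : BorelSpace (Vh h) := ⟨rfl⟩
    exact (hU.memLp_and_eq_comp hτ hμ hL hN hk hkT hA hf hn).1
  · exact error_estimate hT hτ hμ hL hN hk hkT hd hA hf hU hu hγ huγ hAu hAuA
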